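/- Let $\mathscr C:\mathbb R/\mathbb Z\to\mathbb R^2$ be a simple closed curve of class $C^3$, parametrized at unit Euclidean speed, and put $\mathscr N(t):=\mathscr C'(t)^\perp$, where $(a,b)^\perp:=(-b,a)$. Let $\operatorname{lfs}(\mathscr C)$ be the local feature size of $\mathscr C$, i.e. the minimal Euclidean distance from $\mathscr C$ to its medial axis (the closure of the set of points of $\mathbb R^2$ having at least two nearest points on $\mathscr C$). For $r>0$ put $\mathscr T_{(r)}:=\{\mathscr C(t)+u\,\mathscr N(t):\ t\in\mathbb R/\mathbb Z,\ |u|\le r\}$. Write $\operatorname{curl}\omega:=\partial_x\omega_y-\partial_y\omega_x$. Let $0<\alpha<1$ and $M,L\in\mathbb R$. There is a constant $K$, depending only on $\mathscr C$, $\alpha$, $M$ and $L$ (in particular not on $U$), such that the following holds. Let $\Omega\subset\mathbb R^2$ be open, let $0<U\le \operatorname{lfs}(\mathscr C)/3$ be such that the tubular domain $\mathscr T:=\mathscr T_{(U)}$ is contained in $\Omega$, and put $\mathscr T_2:=\mathscr T_{(2U)}$. Let $\mathcal X$ be a topological space (for instance, the set of shapes whose boundary is a curve $\mathscr C+\mu\mathscr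 N$ with $\mu:\mathbb R/\mathbb Z\to[-U,U]$ Lipschitz), and let $\mathfrak S\in\mathcal X\mapsto \xi_{\mathfrak S}\in C^0(\overline\Omega,\mathbb R)$ be continuous for uniform convergence on $\overline\Omega$, with $|\xi_{\mathfrak S}(x)|\le M$ and $|\xi_{\mathfrak S}(x)-\xi_{\mathfrak S}(y)|\le L\|x-y\|^\alpha$ for all $\mathfrak S\in\mathcal X$ and all $x,y\in\overline\Omega$. Then there are vector fields $\omega_{\mathfrak S}$, $\mathfrak S\in\mathcal X$, each of class $C^1$ on a neighbourhood of $\mathscr T$ with values in $\mathbb R^2$, such that for every $\mathfrak S\in\mathcal X$ $$\operatorname{curl}\omega_{\mathfrak S}=\xi_{\mathfrak S}\ \text{ on }\mathscr T,\qquad \|\omega_{\mathfrak S}(x)\|\le K\,U(1+|\ln U|)\ \text{ and }\ \|\mathrm d\omega_{\mathfrak S}(x)\|\le K\ \text{ for all }x\in\mathscr T,$$ and such that $\mathfrak S\in\mathcal X\mapsto\omega_{\mathfrak S}\in C^0(\mathscr T,\mathbb R^2)$ is continuous for uniform convergence on $\mathscr T$. Moreover, if $\mathscr T_2\subset\overline\Omega$,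 these fields can be taken to be given by the truncated logarithmic potential: the function $\varphi_{\mathfrak S}(x):=\int_{\mathscr T_2}\xi_{\mathfrak S}(y)\ln\|x-y\|\,\mathrm dy$ is differentiable at every point of $\mathscr T$, and $\omega_{\mathfrak S}=\frac1{2\pi}(\nabla\varphi_{\mathfrak S})^\perp$ on $\mathscr T$. -/

import Mathlib

open Set Filter Topology MeasureTheory

/-- The Euclidean plane `ℝ²`. -/
abbrev Plane : Type := EuclideanSpace ℝ (Fin 2)

/-- Counter-clockwise rotation by a right angle, `(a, b)^⊥ = (-b, a)`. -/
noncomputable def perp (v : Plane) : Plane := !₂[-(v 1), v 0]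

/-- `curl ω = ∂ₓ ω_y - ∂_y ωₓ`. -/
noncomputable def curl (w : Plane → Plane) (x : Plane) : ℝ :=
  (fderiv ℝ w x (EuclideanSpace.single 0 1)) 1 - (fderiv ℝ w x (EuclideanSpace.single 1 1)) 0

/-- A simple closed curve of class `C³` with unit Euclidean speed; a map on the circle `ℝ/ℤ` is a
`1`-periodic map on `ℝ`. -/
structure IsCenterline (c : ℝ → Plane) : Prop where
  contDiff : ContDiff ℝ 3 c
  periodic : Function.Periodic c 1
  simple : Set.InjOn c (Set.Ico 0 1)
  unit_speed : ∀ t, ‖deriv c t‖ = 1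

/-- The normal `𝒩(t) = c'(t)^⊥`. -/
noncomputable def normalVec (c : ℝ → Plane) (t : ℝ) : Plane := perp (deriv c t)

/-- The tubular coordinates `Φ(t, u) = c(t) + u 𝒩(t)`. -/
noncomputable def tubeMap (c : ℝ → Plane) (t u : ℝ) : Plane := c t + u • normalVec c t

/-- The tubular domain of half-width `U`, the image of `ℝ/ℤ × [-U, U]` under `Φ`. -/
def tube (c : ℝ → Plane) (U : ℝ) : Set Plane :=
  {x | ∃ t : ℝ, ∃ u ∈ Set.Icc (-U) U, x = tubeMap c t u}

/-- The medial axis of the curve `c`: the closure of the set of points that have at least two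
nearest points on the curve. -/
def medialAxis (c : ℝ → Plane) : Set Plane :=
  closure {x | ∃ p ∈ Set.range c, ∃ q ∈ Set.range c, p ≠ q ∧
    dist x p = Metric.infDist x (Set.range c) ∧ dist x q = Metric.infDist x (Set.range c)}

/-- The local feature size of `c`: the least distance from the curve to its medial axis. -/
noncomputable def lfs (c : ℝ → Plane) : ℝ :=
  sInf (Set.image2 dist (Set.range c) (medialAxis c))

/-- The logarithmic potential of the density `ξ` truncated to the set `A`,
`φ(x) = ∫_A ξ(y) ln |x - y| dy`. -/
noncomputable def logPotential (A : Set Plane) (ξ : Plane → ℝ) (x : Plane) : ℝ :=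
  ∫ y in A, ξ y * Real.log ‖x - y‖

/-!
The field is `(2π)⁻¹ (∇φ)^⊥`, where `φ` is the logarithmic potential of `ξ` on the doubled tube
`A = tube c (2 * U)`; its curl is `(2π)⁻¹ Δφ = ξ`. Where `ξ` is not defined on all of `A`, it is
replaced by its McShane extension for the metric `|x - y| ^ α`, truncated at height `M`
(`holderExtend`). The extension keeps the Hölder constant and is `1`-Lipschitz in `ξ` for the
uniform norm, so it preserves the continuous dependence on the parameter.

Interior regularity of `φ` is classical. The kernels are regularized by replacing `|z|²` with
`|z|² + ε²`, and the regularized potential, its gradient and its Hessian are differentiated under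
the integral sign. The Hessian is split by recentring the density at `x`: the kernel of order
`|z|⁻²` is then paired with `f y - f x = O(|x - y| ^ α)`, which is integrable, while its integral
over a disc centred at `x` is exactly `π r² / (r² + ε²)` times the identity, because the sum of the
kernel and its quarter turn is scalar (`setIntegral_ball_hessKernel`). All these terms converge
uniformly in `x` as `ε → 0` (`logPotential_regularity`), and the limit has trace `2π f`
(`logHessian_trace`).

The bounds must not deteriorate as `U → 0`. Besides the recentred integral, the Hessian at
`x ∈ tube c U` involves the integral of `|x - y|⁻²` over `A` outside the disc of radius `U / 2`,
which lies in `A` because the tube is a metric neighbourhood of the curve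
(`IsCenterline.mem_tube_iff`). The tube being thin, this two-dimensional integral is at most a
constant times `U ∫ (U + |c t - x|)⁻² dt` along the curve (`IsCenterline.lintegral_tube_le`). On
short arcs `|c t - x|` grows linearly away from its minimum, so that the line integral is
`O(1 / U)`, whence a bound independent of `U`. The same reduction for `|x - y|⁻¹` gives
`U ∫ (U + |c t - x|)⁻¹ dt = O(U (1 + |ln U|))`, the bound on the field itself
(`IsCenterline.exists_integral_tube_le`).
-/

/-! ### The rotation `perp` -/

/-- The rotation `perp` as a linear isometry of the plane. -/
noncomputable def perpIsometry : Plane →ₗᵢ[ℝ] Plane where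
  toFun := perp
  map_add' v w := by
    ext i; fin_cases i <;> simp [perp]; ring
  map_smul' a v := by
    ext i; fin_cases i <;> simp [perp]
  norm_map' v := by
    have h : ‖perp v‖ ^ 2 = ‖v‖ ^ 2 := by
      simp [EuclideanSpace.real_norm_sq_eq, Fin.sum_univ_two, perp]; ring
    exact (pow_left_inj₀ (norm_nonneg _) (norm_nonneg _) two_ne_zero).1 h

@[simp] lemma perpIsometry_apply (v : Plane) : perpIsometry v = perp v := rfl

/-- The rotation `perp` as a linear isometric equivalence. -/
noncomputable def perpEquiv : Plane ≃ₗᵢ[ℝ] Plane :=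
  perpIsometry.toLinearIsometryEquiv rfl

@[simp] lemma perpEquiv_apply (v : Plane) : perpEquiv v = perp v := rfl

lemma norm_perp (v : Plane) : ‖perp v‖ = ‖v‖ := perpIsometry.norm_map v

lemma perp_sub (v w : Plane) : perp (v - w) = perp v - perp w := perpIsometry.map_sub v w

/-! ### The tube as a closed neighbourhood of the curve -/

/-- A unit vector and its rotation form an orthonormal basis of the plane. -/
lemma exists_eq_smul_perp {a w : Plane} (ha : ‖a‖ = 1) (h : inner ℝ w a = 0) :
    ∃ u : ℝ, |u| = ‖w‖ ∧ w = u • perp a := by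
  have ha' : a 0 ^ 2 + a 1 ^ 2 = 1 := by
    have := EuclideanSpace.real_norm_sq_eq a
    rw [ha, Fin.sum_univ_two] at this
    linarith
  have h' : w 0 * a 0 + w 1 * a 1 = 0 := by
    have : a 0 * w 0 + a 1 * w 1 = 0 := by
      simpa [PiLp.inner_apply, Fin.sum_univ_two] using h
    linarith
  have key : w = (w 1 * a 0 - w 0 * a 1) • perp a := by
    ext i
    fin_cases i
    · simp only [perp, Fin.zero_eta, PiLp.smul_apply, smul_eq_mul,
        Matrix.cons_val_zero]
      linear_combination (-(w 0)) * ha' + a 0 * h'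
    · simp only [perp, Fin.mk_one, PiLp.smul_apply, smul_eq_mul,
        Matrix.cons_val_one, Matrix.cons_val_zero]
      linear_combination (-(w 1)) * ha' + a 1 * h'
  refine ⟨w 1 * a 0 - w 0 * a 1, ?_, key⟩
  conv_rhs => rw [key]
  rw [norm_smul, norm_perp, ha, mul_one, Real.norm_eq_abs]

namespace IsCenterline

variable {c : ℝ → Plane}

lemma continuous (hc : IsCenterline c) : Continuous c := hc.contDiff.continuous

lemma hasDerivAt (hc : IsCenterline c) (t : ℝ) : HasDerivAt c (deriv c t) t :=
  (hc.contDiff.differentiable (by norm_num) t).hasDerivAt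

lemma range_eq (hc : IsCenterline c) : range c = c '' Icc 0 1 := by
  rw [← hc.periodic.image_Icc one_pos 0]; simp

lemma isCompact_range (hc : IsCenterline c) : IsCompact (range c) := by
  rw [hc.range_eq]; exact isCompact_Icc.image hc.continuous

/-- The segment from a point to a nearest point of the curve is normal to the curve, whence the
tube is the set of points at distance at most `r` from the curve, for every `r`. -/
lemma mem_tube_iff (hc : IsCenterline c) {r : ℝ} {y : Plane} :
    y ∈ tube c r ↔ ∃ t ∈ Icc (0 : ℝ) 1, dist y (c t) ≤ r := by
  constructor
  · rintro ⟨t, u, hu, rfl⟩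
    obtain ⟨s, hs, hst⟩ : c t ∈ c '' Icc 0 1 := hc.range_eq ▸ mem_range_self t
    refine ⟨s, hs, ?_⟩
    rw [hst, tubeMap, dist_eq_norm, add_sub_cancel_left, norm_smul, normalVec, norm_perp,
      hc.unit_speed, mul_one]
    exact abs_le.2 hu
  · rintro ⟨t, -, ht⟩
    obtain ⟨p, ⟨s, rfl⟩, hs⟩ := hc.isCompact_range.exists_infDist_eq_dist (range_nonempty c) y
    have hmin : ∀ t', dist y (c s) ≤ dist y (c t') := fun t' ↦
      hs ▸ Metric.infDist_le_dist_of_mem (mem_range_self t')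
    have hder : HasDerivAt (fun t' ↦ ‖y - c t'‖ ^ 2) (2 * inner ℝ (y - c s) (-deriv c s)) s :=
      ((hc.hasDerivAt s).const_sub y).norm_sq
    have hloc : IsLocalMin (fun t' ↦ ‖y - c t'‖ ^ 2) s := by
      refine Filter.Eventually.of_forall fun t' ↦ ?_
      have := hmin t'
      rw [dist_eq_norm, dist_eq_norm] at this
      exact pow_le_pow_left₀ (norm_nonneg _) this 2
    have horth : inner ℝ (y - c s) (deriv c s) = 0 := by
      have := hloc.hasDerivAt_eq_zero hder
      rw [inner_neg_right] at this
      linarith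
    obtain ⟨u, hu, hyu⟩ := exists_eq_smul_perp (hc.unit_speed s) horth
    refine ⟨s, u, abs_le.1 ?_, ?_⟩
    · rw [hu, ← dist_eq_norm]; exact (hmin t).trans ht
    · rw [tubeMap, normalVec, ← hyu, add_sub_cancel]

lemma tube_eq_image (hc : IsCenterline c) (r : ℝ) :
    tube c r = (fun q : ℝ × ℝ ↦ tubeMap c q.1 q.2) '' (Icc 0 1 ×ˢ Icc (-r) r) := by
  ext x
  constructor
  · rintro ⟨t, u, hu, rfl⟩
    have hper : Function.Periodic (fun t ↦ tubeMap c t u) 1 := fun t ↦ by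
      have h1 : deriv c (t + 1) = deriv c t := by
        rw [← deriv_comp_add_const, show (fun x ↦ c (x + 1)) = c from funext hc.periodic]
      simp only [tubeMap, normalVec, hc.periodic t, h1]
    obtain ⟨s, hs, hst⟩ := hper.exists_mem_Ico₀ one_pos t
    exact ⟨(s, u), ⟨Ico_subset_Icc_self hs, hu⟩, hst.symm⟩
  · rintro ⟨⟨t, u⟩, ⟨-, hu⟩, rfl⟩
    exact ⟨t, u, hu, rfl⟩

lemma isCompact_tube (hc : IsCenterline c) (r : ℝ) : IsCompact (tube c r) := by
  rw [hc.tube_eq_image]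
  refine (isCompact_Icc.prod isCompact_Icc).image ?_
  have h1 : Continuous (deriv c) := hc.contDiff.continuous_deriv (by norm_num)
  have h2 : Continuous perp := perpIsometry.continuous
  have h3 := hc.continuous
  unfold tubeMap normalVec
  fun_prop

lemma exists_tube_subset_ball (hc : IsCenterline c) (r₀ : ℝ) :
    ∃ ρ > 0, ∀ r ≤ r₀, ∀ s ≤ r₀, ∀ x ∈ tube c s, tube c r ⊆ Metric.ball x ρ := by
  obtain ⟨R, hR⟩ := (hc.isCompact_tube r₀).isBounded.subset_closedBall 0
  have hmono : ∀ r ≤ r₀, tube c r ⊆ tube c r₀ := fun r hr x hx ↦ by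
    rw [hc.mem_tube_iff] at hx ⊢
    exact hx.imp fun t ht ↦ ⟨ht.1, ht.2.trans hr⟩
  refine ⟨2 * |R| + 1, by positivity, fun r hr s hs x hx y hy ↦ ?_⟩
  have h1 : dist y 0 ≤ R := hR (hmono r hr hy)
  have h2 : dist x 0 ≤ R := hR (hmono s hs hx)
  rw [Metric.mem_ball]
  linarith [dist_triangle_right y x 0, le_abs_self R]

lemma closedBall_subset_tube (hc : IsCenterline c) {r s R : ℝ} (h : r + s ≤ R) {x : Plane}
    (hx : x ∈ tube c r) : Metric.closedBall x s ⊆ tube c R := by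
  intro y hy
  rw [hc.mem_tube_iff] at hx ⊢
  obtain ⟨t, ht, hxt⟩ := hx
  refine ⟨t, ht, ?_⟩
  linarith [dist_triangle y x (c t), Metric.mem_closedBall.1 hy]

end IsCenterline

/-! ### Extension of Hölder functions -/

/-- The McShane extension `x ↦ inf_{y ∈ s} (f y + L |x - y| ^ α)` of `f` from `s`, truncated to
`[-M, M]`. -/
noncomputable def holderExtend (s : Set Plane) (α M L : ℝ) (f : Plane → ℝ) (x : Plane) : ℝ :=
  max (-M) (min M (⨅ y : s, (f y + L * ‖x - y‖ ^ α)))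

section holderExtend

variable {s : Set Plane} {α M L : ℝ} {f g : Plane → ℝ}

lemma bddBelow_range_mcShane (hL : 0 ≤ L) (hf : ∀ x ∈ s, |f x| ≤ M) (x : Plane) :
    BddBelow (range fun y : s ↦ f y + L * ‖x - y‖ ^ α) := by
  refine ⟨-M, ?_⟩
  rintro _ ⟨y, rfl⟩
  have := (abs_le.1 (hf y y.2)).1
  have : 0 ≤ L * ‖x - y‖ ^ α := by positivity
  simp only
  linarith

lemma abs_clamp_sub_clamp_le (M a b : ℝ) :
    |max (-M) (min M a) - max (-M) (min M b)| ≤ |a - b| := by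
  refine (abs_max_sub_max_le_max _ _ _ _).trans ?_
  rw [sub_self, abs_zero, max_eq_right (abs_nonneg _)]
  refine (abs_min_sub_min_le_max _ _ _ _).trans ?_
  rw [sub_self, abs_zero, max_eq_right (abs_nonneg _)]

lemma abs_holderExtend_le (hM : 0 ≤ M) (x : Plane) : |holderExtend s α M L f x| ≤ M :=
  abs_le.2 ⟨le_max_left _ _, max_le (by linarith) (min_le_left _ _)⟩

lemma holderExtend_eq (hα : 0 < α) (hL : 0 ≤ L) (hf : ∀ x ∈ s, |f x| ≤ M)
    (hf' : ∀ x ∈ s, ∀ y ∈ s, |f x - f y| ≤ L * ‖x - y‖ ^ α) {x : Plane} (hx : x ∈ s) :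
    holderExtend s α M L f x = f x := by
  have : Nonempty s := ⟨⟨x, hx⟩⟩
  have h : ⨅ y : s, (f y + L * ‖x - y‖ ^ α) = f x := by
    apply le_antisymm
    · refine (ciInf_le (bddBelow_range_mcShane hL hf x) ⟨x, hx⟩).trans ?_
      simp [Real.zero_rpow hα.ne']
    · refine le_ciInf fun y ↦ ?_
      linarith [(abs_le.1 (hf' x hx y y.2)).2]
  have h1 := abs_le.1 (hf x hx)
  rw [holderExtend, h, min_eq_right h1.2, max_eq_right h1.1]

lemma abs_holderExtend_sub_le (hα0 : 0 < α) (hα1 : α < 1) (hL : 0 ≤ L)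
    (hf : ∀ x ∈ s, |f x| ≤ M) (x x' : Plane) :
    |holderExtend s α M L f x - holderExtend s α M L f x'| ≤ L * ‖x - x'‖ ^ α := by
  refine (abs_clamp_sub_clamp_le _ _ _).trans ?_
  rcases isEmpty_or_nonempty s with h | h
  · simp only [Real.iInf_of_isEmpty, sub_self, abs_zero]; positivity
  have key : ∀ x x' : Plane, ⨅ y : s, (f y + L * ‖x - y‖ ^ α) ≤
      (⨅ y : s, (f y + L * ‖x' - y‖ ^ α)) + L * ‖x - x'‖ ^ α := by
    intro x x'
    rw [← sub_le_iff_le_add]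
    refine le_ciInf fun y ↦ ?_
    rw [sub_le_iff_le_add]
    refine (ciInf_le (bddBelow_range_mcShane hL hf x) y).trans ?_
    have h1 : ‖x - y‖ ^ α ≤ ‖x' - y‖ ^ α + ‖x - x'‖ ^ α := by
      refine (Real.rpow_le_rpow (norm_nonneg _) ?_ hα0.le).trans
        (Real.rpow_add_le_add_rpow (norm_nonneg _) (norm_nonneg _) hα0.le hα1.le)
      rw [add_comm]; exact norm_sub_le_norm_sub_add_norm_sub x x' y
    nlinarith
  rw [abs_sub_le_iff]
  have h2 := key x' x
  rw [norm_sub_rev x' x] at h2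
  constructor <;> linarith [key x x']

lemma abs_holderExtend_sub_holderExtend_le {ε : ℝ} (hL : 0 ≤ L) (hε : 0 ≤ ε)
    (hf : ∀ x ∈ s, |f x| ≤ M) (hg : ∀ x ∈ s, |g x| ≤ M) (hfg : ∀ x ∈ s, |f x - g x| ≤ ε)
    (x : Plane) : |holderExtend s α M L f x - holderExtend s α M L g x| ≤ ε := by
  refine (abs_clamp_sub_clamp_le _ _ _).trans ?_
  rcases isEmpty_or_nonempty s with h | h
  · simpa only [Real.iInf_of_isEmpty, sub_self, abs_zero]
  have key : ∀ f g : Plane → ℝ, (∀ x ∈ s, |f x| ≤ M) → (∀ x ∈ s, |f x - g x| ≤ ε) →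
      ⨅ y : s, (f y + L * ‖x - y‖ ^ α) ≤ (⨅ y : s, (g y + L * ‖x - y‖ ^ α)) + ε := by
    intro f g hf hfg
    rw [← sub_le_iff_le_add]
    refine le_ciInf fun y ↦ ?_
    rw [sub_le_iff_le_add]
    refine (ciInf_le (bddBelow_range_mcShane hL hf x) y).trans ?_
    linarith [(abs_le.1 (hfg y y.2)).2]
  rw [abs_sub_le_iff]
  constructor
  · linarith [key f g hf hfg]
  · linarith [key g f hg fun x hx ↦ (abs_sub_comm _ _).trans_le (hfg x hx)]

end holderExtend

/-! ### Radial integrals -/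

lemma setIntegral_ball_comp_norm (g : ℝ → ℝ) {ρ : ℝ} (hρ : 0 ≤ ρ) :
    ∫ z in Metric.ball (0 : Plane) ρ, g ‖z‖ = 2 * Real.pi * ∫ s in (0 : ℝ)..ρ, s * g s := by
  have h1 : ∫ z in Metric.ball (0 : Plane) ρ, g ‖z‖ =
      ∫ z : Plane, (Iio ρ).indicator g ‖z‖ := by
    rw [← integral_indicator Metric.isOpen_ball.measurableSet]
    refine integral_congr_ae (Eventually.of_forall fun z ↦ ?_)
    classical simp [indicator_apply]
  have h2 : ∫ s in Ioi (0 : ℝ), s ^ (2 - 1) • (Iio ρ).indicator g s =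
      ∫ s in (0 : ℝ)..ρ, s * g s := by
    rw [intervalIntegral.integral_of_le hρ, integral_Ioc_eq_integral_Ioo,
      ← integral_indicator measurableSet_Ioi, ← integral_indicator measurableSet_Ioo]
    congr 1
    ext s
    by_cases h3 : 0 < s <;> by_cases h4 : s < ρ <;> simp [h3, h4, indicator_apply]
  have h3 : (volume : Measure Plane).real (Metric.ball 0 1) = Real.pi := by
    rw [Measure.real, EuclideanSpace.volume_ball_fin_two]
    simp [Real.pi_nonneg]
  rw [h1, integral_fun_norm_addHaar, finrank_euclideanSpace_fin, h3, h2]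
  simp; ring

lemma integrableOn_ball_norm_rpow {β ρ : ℝ} (hβ : 0 < β) :
    IntegrableOn (fun z : Plane ↦ ‖z‖ ^ (β - 2)) (Metric.ball 0 ρ) := by
  rw [← integrable_indicator_iff Metric.isOpen_ball.measurableSet]
  have h1 : (Metric.ball (0 : Plane) ρ).indicator (fun z ↦ ‖z‖ ^ (β - 2)) =
      fun z ↦ (Iio ρ).indicator (fun s : ℝ ↦ s ^ (β - 2)) ‖z‖ := by
    ext z; classical simp [indicator_apply]
  rw [h1, integrable_fun_norm_addHaar, finrank_euclideanSpace_fin]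
  have h2 : IntegrableOn (fun s : ℝ ↦ s ^ (β - 1)) (Ioc 0 ρ) := by
    rcases le_or_gt 0 ρ with hρ | hρ
    · have := intervalIntegral.intervalIntegrable_rpow' (a := 0) (b := ρ) (r := β - 1)
        (by linarith)
      rwa [intervalIntegrable_iff_integrableOn_Ioc_of_le hρ] at this
    · simp [Ioc_eq_empty hρ.not_gt]
  have h3 : IntegrableOn (fun s : ℝ ↦ s ^ (β - 1)) (Ioo 0 ρ) := h2.mono_set Ioo_subset_Ioc_self
  rw [← integrable_indicator_iff measurableSet_Ioo] at h3
  rw [← integrable_indicator_iff measurableSet_Ioi]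
  refine h3.congr (Eventually.of_forall fun s ↦ ?_)
  by_cases h3 : 0 < s <;> by_cases h4 : s < ρ <;> simp [h3, h4, indicator_apply]
  rw [show β - 1 = 1 + (β - 2) by ring, Real.rpow_add h3, Real.rpow_one]

lemma setIntegral_ball_norm_rpow {β ρ : ℝ} (hβ : 0 < β) (hρ : 0 ≤ ρ) :
    ∫ z in Metric.ball (0 : Plane) ρ, ‖z‖ ^ (β - 2) = 2 * Real.pi * (ρ ^ β / β) := by
  rw [setIntegral_ball_comp_norm (fun s ↦ s ^ (β - 2)) hρ]
  congr 1
  have : ∫ s in (0 : ℝ)..ρ, s * s ^ (β - 2) = ∫ s in (0 : ℝ)..ρ, s ^ (β - 1) := by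
    refine intervalIntegral.integral_congr_ae (Eventually.of_forall fun s hs ↦ ?_)
    rw [uIoc_of_le hρ] at hs
    rw [show β - 1 = 1 + (β - 2) by ring, Real.rpow_add hs.1, Real.rpow_one]
  rw [this, integral_rpow (Or.inl (by linarith))]
  simp [Real.zero_rpow hβ.ne']

lemma setIntegral_ball_comp_sub {F : Type*} [NormedAddCommGroup F] [NormedSpace ℝ F]
    (g : Plane → F) (x : Plane) (ρ : ℝ) :
    ∫ y in Metric.ball x ρ, g (x - y) = ∫ z in Metric.ball (0 : Plane) ρ, g z := by
  rw [← integral_indicator Metric.isOpen_ball.measurableSet,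
    ← integral_indicator Metric.isOpen_ball.measurableSet,
    ← integral_sub_left_eq_self _ _ x]
  congr 1
  ext y
  classical simp [indicator_apply, dist_eq_norm]

lemma integrableOn_ball_norm_sub_rpow {β ρ : ℝ} (hβ : 0 < β) (x : Plane) :
    IntegrableOn (fun y : Plane ↦ ‖x - y‖ ^ (β - 2)) (Metric.ball x ρ) := by
  have h := integrableOn_ball_norm_rpow (ρ := ρ) hβ
  rw [← integrable_indicator_iff Metric.isOpen_ball.measurableSet] at h ⊢
  refine (h.comp_sub_left x).congr (Eventually.of_forall fun y ↦ ?_)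
  classical simp [indicator_apply, dist_eq_norm, norm_sub_rev]

lemma integrableOn_norm_sub_rpow {A : Set Plane} {β ρ : ℝ} (hβ : 0 < β) {x : Plane}
    (hA : A ⊆ Metric.ball x ρ) : IntegrableOn (fun y : Plane ↦ ‖x - y‖ ^ (β - 2)) A :=
  (integrableOn_ball_norm_sub_rpow hβ x).mono_set hA

lemma setIntegral_norm_sub_rpow_le {A : Set Plane} {β ρ : ℝ} (hβ : 0 < β) (hρ : 0 ≤ ρ)
    {x : Plane} (hA : A ⊆ Metric.ball x ρ) :
    ∫ y in A, ‖x - y‖ ^ (β - 2) ≤ 2 * Real.pi * (ρ ^ β / β) := by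
  rw [← setIntegral_ball_norm_rpow hβ hρ, ← setIntegral_ball_comp_sub _ x]
  exact setIntegral_mono_set (integrableOn_ball_norm_sub_rpow hβ x)
    (Eventually.of_forall fun y ↦ by positivity) hA.eventuallyLE

/-! ### The regularized kernels -/

/-- The kernel `z / (|z|² + ε²)`; for `ε = 0` it is the gradient `z / |z|²` of `ln |z|`,
with the value `0` at the origin. -/
noncomputable def gradKernel (ε : ℝ) (z : Plane) : Plane := (‖z‖ ^ 2 + ε ^ 2)⁻¹ • z

/-- The derivative `(|z|² + ε²)⁻¹ I - 2 (|z|² + ε²)⁻² z ⊗ z` of `gradKernel ε`; for `ε = 0` it is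
the Hessian of `ln |z|`, with the value `0` at the origin. -/
noncomputable def hessKernel (ε : ℝ) (z : Plane) : Plane →L[ℝ] Plane :=
  (‖z‖ ^ 2 + ε ^ 2)⁻¹ • ContinuousLinearMap.id ℝ Plane -
    (2 * ((‖z‖ ^ 2 + ε ^ 2)⁻¹) ^ 2) • (innerSL ℝ z).smulRight z

lemma hessKernel_apply (ε : ℝ) (z v : Plane) :
    hessKernel ε z v = (‖z‖ ^ 2 + ε ^ 2)⁻¹ • v -
      (2 * ((‖z‖ ^ 2 + ε ^ 2)⁻¹) ^ 2 * inner ℝ z v) • z := by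
  simp [hessKernel, smul_smul]

section kernels

variable {ε : ℝ}

lemma continuous_gradKernel (hε : 0 < ε) : Continuous (gradKernel ε) := by
  unfold gradKernel
  have : ∀ z : Plane, ‖z‖ ^ 2 + ε ^ 2 ≠ 0 := fun z ↦ by positivity
  fun_prop (disch := assumption)

lemma continuous_hessKernel (hε : 0 < ε) : Continuous (hessKernel ε) := by
  unfold hessKernel
  have h : ∀ z : Plane, ‖z‖ ^ 2 + ε ^ 2 ≠ 0 := fun z ↦ by positivity
  have h1 : Continuous fun z : Plane ↦ (‖z‖ ^ 2 + ε ^ 2)⁻¹ := by fun_prop (disch := assumption)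
  have h2 : Continuous fun z : Plane ↦ (innerSL ℝ z).smulRight z := by
    exact ((ContinuousLinearMap.smulRightL ℝ Plane Plane).continuous₂).comp
      ((innerSL ℝ).continuous.prodMk continuous_id)
  exact (h1.smul continuous_const).sub ((continuous_const.mul (h1.pow 2)).smul h2)

lemma measurable_gradKernel (ε : ℝ) : Measurable (gradKernel ε) := by
  unfold gradKernel
  fun_prop

lemma stronglyMeasurable_hessKernel (ε : ℝ) : StronglyMeasurable (hessKernel ε) := by
  unfold hessKernel
  have h1 : StronglyMeasurable fun z : Plane ↦ (‖z‖ ^ 2 + ε ^ 2)⁻¹ := by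
    apply Measurable.stronglyMeasurable; fun_prop
  have h2 : StronglyMeasurable fun z : Plane ↦ (innerSL ℝ z).smulRight z :=
    (((ContinuousLinearMap.smulRightL ℝ Plane Plane).continuous₂).comp
      ((innerSL ℝ).continuous.prodMk continuous_id)).stronglyMeasurable
  exact (h1.smul stronglyMeasurable_const).sub
    ((stronglyMeasurable_const.mul (h1.pow 2)).smul h2)

lemma hasGradientAt_log (hε : 0 < ε) (z : Plane) :
    HasGradientAt (fun z : Plane ↦ Real.log (‖z‖ ^ 2 + ε ^ 2) / 2) (gradKernel ε z) z := by
  have h : ‖z‖ ^ 2 + ε ^ 2 ≠ 0 := by positivity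
  have h1 : HasFDerivAt (fun z : Plane ↦ ‖z‖ ^ 2 + ε ^ 2) (2 • innerSL ℝ z) z :=
    (hasStrictFDerivAt_norm_sq z).hasFDerivAt.add_const _
  rw [hasGradientAt_iff_hasFDerivAt]
  refine ((h1.log h).mul_const (2 : ℝ)⁻¹).congr_fderiv ?_
  ext v
  simp [gradKernel]
  ring

lemma hasFDerivAt_gradKernel (hε : 0 < ε) (z : Plane) :
    HasFDerivAt (gradKernel ε) (hessKernel ε z) z := by
  have h : ‖z‖ ^ 2 + ε ^ 2 ≠ 0 := by positivity
  have h1 : HasFDerivAt (fun z : Plane ↦ ‖z‖ ^ 2 + ε ^ 2) (2 • innerSL ℝ z) z :=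
    (hasStrictFDerivAt_norm_sq z).hasFDerivAt.add_const _
  refine (((hasDerivAt_inv h).comp_hasFDerivAt z h1).smul (hasFDerivAt_id z)).congr_fderiv ?_
  ext1 v
  rw [hessKernel_apply]
  simp [sub_eq_add_neg]
  congr 1
  ring

lemma norm_smulRight_innerSL (z : Plane) : ‖(innerSL ℝ z).smulRight z‖ = ‖z‖ ^ 2 := by
  rw [ContinuousLinearMap.norm_smulRight_apply, innerSL_apply_norm, sq]

lemma norm_gradKernel_le (ε : ℝ) (z : Plane) : ‖gradKernel ε z‖ ≤ ‖z‖⁻¹ := by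
  rcases eq_or_ne z 0 with rfl | hz
  · simp [gradKernel]
  have hz' : 0 < ‖z‖ := norm_pos_iff.2 hz
  rw [gradKernel, norm_smul, Real.norm_of_nonneg (by positivity), ← div_eq_inv_mul,
    div_le_iff₀ (by positivity), ← div_eq_inv_mul, le_div_iff₀ hz']
  nlinarith [sq_nonneg ε]

lemma norm_gradKernel_le' (hε : 0 < ε) (z : Plane) : ‖gradKernel ε z‖ ≤ ε⁻¹ := by
  rw [gradKernel, norm_smul, Real.norm_of_nonneg (by positivity), ← div_eq_inv_mul,
    div_le_iff₀ (by positivity), ← div_eq_inv_mul, le_div_iff₀ hε]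
  nlinarith [sq_nonneg (‖z‖ - ε), sq_nonneg ε, sq_nonneg ‖z‖]

lemma norm_hessKernel_le_inv (ε : ℝ) (z : Plane) :
    ‖hessKernel ε z‖ ≤ 3 * (‖z‖ ^ 2 + ε ^ 2)⁻¹ := by
  set s := ‖z‖ ^ 2 + ε ^ 2 with hs
  have hs0 : 0 ≤ s := by positivity
  refine (norm_sub_le _ _).trans ?_
  rw [← hs, norm_smul, norm_smul, norm_smulRight_innerSL, ContinuousLinearMap.norm_id, mul_one,
    Real.norm_of_nonneg (by positivity), Real.norm_of_nonneg (by positivity)]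
  have h1 : s⁻¹ * ‖z‖ ^ 2 ≤ 1 := by
    rw [← div_eq_inv_mul]
    exact div_le_one_of_le₀ (by rw [hs]; nlinarith [sq_nonneg ε]) hs0
  have h2 : 0 ≤ s⁻¹ := by positivity
  nlinarith

lemma norm_hessKernel_le (ε : ℝ) {z : Plane} (hz : z ≠ 0) :
    ‖hessKernel ε z‖ ≤ 3 * (‖z‖ ^ 2)⁻¹ := by
  refine (norm_hessKernel_le_inv ε z).trans ?_
  have : 0 < ‖z‖ := norm_pos_iff.2 hz
  gcongr
  nlinarith [sq_nonneg ε]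

lemma norm_hessKernel_le' (hε : 0 < ε) (z : Plane) : ‖hessKernel ε z‖ ≤ 3 * (ε ^ 2)⁻¹ := by
  refine (norm_hessKernel_le_inv ε z).trans ?_
  gcongr
  nlinarith [sq_nonneg ‖z‖]

lemma norm_gradKernel_sub_le (hε : 0 < ε) (z : Plane) :
    ‖gradKernel ε z - gradKernel 0 z‖ ≤ ε ^ 2 / (‖z‖ ^ 2 + ε ^ 2) * ‖z‖⁻¹ := by
  rcases eq_or_ne z 0 with rfl | hz
  · simp [gradKernel]
  have hz' : 0 < ‖z‖ := norm_pos_iff.2 hz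
  have h : gradKernel ε z - gradKernel 0 z =
      (-(ε ^ 2 / (‖z‖ ^ 2 + ε ^ 2) * (‖z‖ ^ 2)⁻¹)) • z := by
    rw [gradKernel, gradKernel, ← sub_smul]
    congr 1
    have : ‖z‖ ^ 2 + ε ^ 2 ≠ 0 := by positivity
    simp
    field_simp
    ring
  rw [h, norm_smul, norm_neg, Real.norm_of_nonneg (by positivity)]
  refine le_of_eq ?_
  field_simp

lemma norm_hessKernel_sub_le (hε : 0 < ε) {z : Plane} (hz : z ≠ 0) :
    ‖hessKernel ε z - hessKernel 0 z‖ ≤ 5 * (ε ^ 2 / (‖z‖ ^ 2 + ε ^ 2)) * (‖z‖ ^ 2)⁻¹ := by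
  have hz' : 0 < ‖z‖ := norm_pos_iff.2 hz
  set s := ‖z‖ ^ 2 + ε ^ 2 with hs
  have hs0 : 0 < s := by positivity
  have h : hessKernel ε z - hessKernel 0 z =
      (-(ε ^ 2 / s * (‖z‖ ^ 2)⁻¹)) • ContinuousLinearMap.id ℝ Plane +
      (2 * (ε ^ 2 / s * (‖z‖ ^ 2)⁻¹ * (s⁻¹ + (‖z‖ ^ 2)⁻¹))) • (innerSL ℝ z).smulRight z := by
    have e1 : s⁻¹ = (‖z‖ ^ 2)⁻¹ - ε ^ 2 / s * (‖z‖ ^ 2)⁻¹ := by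
      field_simp; rw [hs]; ring
    have e2 : s⁻¹ - (‖z‖ ^ 2)⁻¹ = -(ε ^ 2 / s * (‖z‖ ^ 2)⁻¹) := by linarith
    ext1 v
    simp only [_root_.sub_apply, _root_.add_apply, _root_.smul_apply, hessKernel_apply, ← hs,
      ContinuousLinearMap.id_apply, ContinuousLinearMap.smulRight_apply, innerSL_apply_apply, ne_eq,
      OfNat.ofNat_ne_zero, not_false_eq_true, zero_pow, add_zero]
    match_scalars
    · linear_combination e2
    · linear_combination (-2 * (s⁻¹ + (‖z‖ ^ 2)⁻¹) * inner ℝ z v) * e2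
  rw [h]
  refine (norm_add_le _ _).trans ?_
  rw [norm_smul, norm_smul, norm_smulRight_innerSL, ContinuousLinearMap.norm_id, mul_one,
    norm_neg, Real.norm_of_nonneg (by positivity), Real.norm_of_nonneg (by positivity)]
  have h1 : s⁻¹ * ‖z‖ ^ 2 ≤ 1 := by
    rw [← div_eq_inv_mul]
    exact div_le_one_of_le₀ (by rw [hs]; nlinarith [sq_nonneg ε]) hs0.le
  have h2 : (‖z‖ ^ 2)⁻¹ * ‖z‖ ^ 2 = 1 := inv_mul_cancel₀ (by positivity)
  have h3 : 0 ≤ ε ^ 2 / s * (‖z‖ ^ 2)⁻¹ := by positivity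
  nlinarith

/-- The error factor of the regularization beats every power of `ε / |z|` up to the second. -/
lemma sq_div_le_rpow (hε : 0 < ε) {θ : ℝ} (hθ0 : 0 ≤ θ) (hθ2 : θ ≤ 2) {a : ℝ} (ha : 0 < a) :
    ε ^ 2 / (a ^ 2 + ε ^ 2) ≤ (ε / a) ^ θ := by
  rcases le_total 1 (ε / a) with h | h
  · refine le_trans ?_ (Real.one_le_rpow h hθ0)
    exact div_le_one_of_le₀ (by nlinarith [sq_nonneg a]) (by positivity)
  · refine le_trans ?_ (Real.rpow_le_rpow_of_exponent_ge (by positivity) h hθ2)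
    rw [Real.rpow_two, div_pow]
    gcongr
    nlinarith [sq_nonneg ε]

lemma hessKernel_add_hessKernel_perp (hε : 0 < ε) (z : Plane) :
    hessKernel ε z + hessKernel ε (perp z) =
      (2 * (ε ^ 2 / (‖z‖ ^ 2 + ε ^ 2) ^ 2)) • ContinuousLinearMap.id ℝ Plane := by
  have hs : ‖z‖ ^ 2 + ε ^ 2 ≠ 0 := by positivity
  ext1 v
  simp only [_root_.add_apply, hessKernel_apply, norm_perp,
    _root_.smul_apply, ContinuousLinearMap.id_apply]
  have hn : ‖z‖ ^ 2 = z 0 ^ 2 + z 1 ^ 2 := by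
    rw [EuclideanSpace.real_norm_sq_eq, Fin.sum_univ_two]
  have hi : inner ℝ z v = z 0 * v 0 + z 1 * v 1 := by
    simp [PiLp.inner_apply, Fin.sum_univ_two]; ring
  have hj : inner ℝ (perp z) v = -(z 1) * v 0 + z 0 * v 1 := by
    simp [PiLp.inner_apply, Fin.sum_univ_two, perp]; ring
  rw [hi, hj]
  generalize hS : ‖z‖ ^ 2 + ε ^ 2 = s at hs
  have hε2 : ε ^ 2 = s - z 0 ^ 2 - z 1 ^ 2 := by rw [← hS, hn]; ring
  rw [hε2]
  ext i
  fin_cases i <;> simp [perp] <;> field_simp <;> ring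

/-- Averaging the kernel over a quarter turn leaves a multiple of the identity; this is how the
delta mass of the Laplacian of the logarithm appears. -/
lemma setIntegral_ball_hessKernel (hε : 0 < ε) {r : ℝ} (hr : 0 ≤ r) :
    ∫ z in Metric.ball (0 : Plane) r, hessKernel ε z =
      (Real.pi * (r ^ 2 / (r ^ 2 + ε ^ 2))) • ContinuousLinearMap.id ℝ Plane := by
  have hperp : ∫ z in Metric.ball (0 : Plane) r, hessKernel ε (perp z) =
      ∫ z in Metric.ball (0 : Plane) r, hessKernel ε z := by
    have := perpEquiv.measurePreserving.setIntegral_preimage_emb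
      perpEquiv.toHomeomorph.measurableEmbedding (hessKernel ε) (Metric.ball 0 r)
    rw [← this]
    congr 2
    ext z; simp
  have hint : IntegrableOn (hessKernel ε) (Metric.ball 0 r) :=
    ((continuous_hessKernel hε).continuousOn.integrableOn_compact
      (isCompact_closedBall (0 : Plane) r)).mono_set Metric.ball_subset_closedBall
  have hint' : IntegrableOn (fun z ↦ hessKernel ε (perp z)) (Metric.ball 0 r) :=
    (((continuous_hessKernel hε).comp
      perpIsometry.continuous).continuousOn.integrableOn_compact
      (isCompact_closedBall (0 : Plane) r)).mono_set Metric.ball_subset_closedBall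
  have hsum := integral_add hint hint'
  simp_rw [hessKernel_add_hessKernel_perp hε] at hsum
  rw [hperp, integral_smul_const, integral_const_mul,
    setIntegral_ball_comp_norm (fun s ↦ ε ^ 2 / (s ^ 2 + ε ^ 2) ^ 2) hr] at hsum
  have hrad : ∫ s in (0 : ℝ)..r, s * (ε ^ 2 / (s ^ 2 + ε ^ 2) ^ 2) =
      r ^ 2 / (r ^ 2 + ε ^ 2) / 2 := by
    have hd : ∀ s : ℝ, HasDerivAt (fun s ↦ s ^ 2 / (s ^ 2 + ε ^ 2) / 2)
        (s * (ε ^ 2 / (s ^ 2 + ε ^ 2) ^ 2)) s := by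
      intro s
      have hs : s ^ 2 + ε ^ 2 ≠ 0 := by positivity
      have h1 : HasDerivAt (fun s : ℝ ↦ s ^ 2) (2 * s) s := by simpa using hasDerivAt_pow 2 s
      refine ((h1.div (h1.add_const _) hs).div_const 2).congr_deriv ?_
      field_simp
      ring
    rw [intervalIntegral.integral_eq_sub_of_hasDerivAt (fun s _ ↦ hd s)]
    · simp
    · apply Continuous.intervalIntegrable
      have : ∀ s : ℝ, (s ^ 2 + ε ^ 2) ^ 2 ≠ 0 := fun s ↦ by positivity
      fun_prop (disch := assumption)
  rw [hrad, ← two_smul ℝ] at hsum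
  have := congrArg (fun T ↦ (2 : ℝ)⁻¹ • T) hsum
  simp only [smul_smul] at this
  rw [inv_mul_cancel₀ two_ne_zero, one_smul] at this
  rw [← this]
  congr 1
  ring

/-- Away from the origin the logarithm is harmonic. -/
lemma hessKernel_zero_trace (z : Plane) :
    (hessKernel 0 z (EuclideanSpace.single 0 1)) 0 +
      (hessKernel 0 z (EuclideanSpace.single 1 1)) 1 = 0 := by
  have hn : ‖z‖ ^ 2 = z 0 ^ 2 + z 1 ^ 2 := by
    rw [EuclideanSpace.real_norm_sq_eq, Fin.sum_univ_two]
  rcases eq_or_ne z 0 with rfl | hz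
  · simp [hessKernel_apply]
  have hz' : ‖z‖ ^ 2 ≠ 0 := by simpa using hz
  simp only [hessKernel_apply, hn] at hz' ⊢
  simp [PiLp.inner_apply]
  field_simp
  ring

/-- The regularized logarithm is close to the logarithm. -/
lemma abs_log_regularized_sub_log_le (hε : 0 < ε) {a : ℝ} (ha : 0 < a) :
    |Real.log (a ^ 2 + ε ^ 2) / 2 - Real.log a| ≤ ε * a⁻¹ := by
  have h1 : Real.log (a ^ 2 + ε ^ 2) / 2 - Real.log a =
      Real.log ((a ^ 2 + ε ^ 2) / a ^ 2) / 2 := by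
    rw [Real.log_div (by positivity) (by positivity), Real.log_pow]; push_cast; ring
  have h2 : 1 ≤ (a ^ 2 + ε ^ 2) / a ^ 2 := by
    rw [le_div_iff₀ (by positivity)]; nlinarith [sq_nonneg ε]
  rw [h1, abs_of_nonneg (by have := Real.log_nonneg h2; positivity)]
  have h3 : (a ^ 2 + ε ^ 2) / a ^ 2 ≤ (1 + ε * a⁻¹) ^ 2 := by
    have : (a ^ 2 + ε ^ 2) / a ^ 2 = 1 + (ε * a⁻¹) ^ 2 := by field_simp
    rw [this]
    nlinarith [show 0 ≤ ε * a⁻¹ by positivity]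
  have h4 := Real.log_le_log (by linarith) h3
  rw [Real.log_pow] at h4
  have h5 := Real.log_le_sub_one_of_pos (show 0 < 1 + ε * a⁻¹ by positivity)
  push_cast at h4
  linarith

end kernels

/-! ### Logarithmic potentials of Hölder densities -/

/-- The field `x ↦ ∫_A f(y) (x - y) / (|x - y|² + ε²) dy`; for `ε = 0` it is the gradient of the
logarithmic potential. -/
noncomputable def gradPotential (A : Set Plane) (f : Plane → ℝ) (ε : ℝ) (x : Plane) : Plane :=
  ∫ y in A, f y • gradKernel ε (x - y)

/-- The derivative of the regularized field `gradPotential A f ε`, for `ε ≠ 0`. -/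
noncomputable def hessPotential (A : Set Plane) (f : Plane → ℝ) (ε : ℝ) (x : Plane) :
    Plane →L[ℝ] Plane :=
  ∫ y in A, f y • hessKernel ε (x - y)

/-- The Hessian of the logarithmic potential of `f` at a point `x` with `ball x r ⊆ A`: the
singular integral with the density recentred at `x`, the contribution of the complement of the
ball, and the mass `π I` carried by the ball. -/
noncomputable def logHessian (A : Set Plane) (f : Plane → ℝ) (r : ℝ) (x : Plane) :
    Plane →L[ℝ] Plane :=
  (∫ y in A, (f y - f x) • hessKernel 0 (x - y)) +
    f x • ((∫ y in A \ Metric.ball x r, hessKernel 0 (x - y)) +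
      Real.pi • ContinuousLinearMap.id ℝ Plane)

section regularized

variable {A : Set Plane} {f : Plane → ℝ} {ε : ℝ}

lemma hasGradientAt_regularized_logPotential (hA : IsCompact A) (hf : Continuous f) (hε : 0 < ε)
    (x : Plane) :
    HasGradientAt (fun x ↦ ∫ y in A, f y * (Real.log (‖x - y‖ ^ 2 + ε ^ 2) / 2))
      (gradPotential A f ε x) x := by
  have hlog : ∀ x : Plane, Continuous fun y ↦ f y * (Real.log (‖x - y‖ ^ 2 + ε ^ 2) / 2) := by
    intro x
    have : ∀ y : Plane, ‖x - y‖ ^ 2 + ε ^ 2 ≠ 0 := fun y ↦ by positivity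
    fun_prop (disch := assumption)
  have hk : Continuous fun y ↦ f y • gradKernel ε (x - y) :=
    hf.smul ((continuous_gradKernel hε).comp (by fun_prop))
  rw [hasGradientAt_iff_hasFDerivAt]
  have hint : IntegrableOn (fun y ↦ f y • gradKernel ε (x - y)) A :=
    hk.continuousOn.integrableOn_compact hA
  have hcomm : (InnerProductSpace.toDual ℝ Plane) (gradPotential A f ε x) =
      ∫ y in A, f y • (InnerProductSpace.toDual ℝ Plane) (gradKernel ε (x - y)) := by
    have := (InnerProductSpace.toDual ℝ Plane).toContinuousLinearEquiv.toContinuousLinearMap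
      |>.integral_comp_comm hint
    simpa [gradPotential] using this.symm
  rw [hcomm]
  refine hasFDerivAt_integral_of_dominated_of_fderiv_le (𝕜 := ℝ) (s := univ)
    (F := fun x y ↦ f y * (Real.log (‖x - y‖ ^ 2 + ε ^ 2) / 2))
    (F' := fun x y ↦ f y • (InnerProductSpace.toDual ℝ Plane) (gradKernel ε (x - y)))
    (bound := fun y ↦ |f y| * ε⁻¹) univ_mem ?_ ?_ ?_ ?_ ?_ ?_
  · exact Eventually.of_forall fun x ↦ (hlog x).aestronglyMeasurable
  · exact (hlog x).continuousOn.integrableOn_compact hA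
  · exact (hf.smul ((InnerProductSpace.toDual ℝ Plane).continuous.comp
      ((continuous_gradKernel hε).comp (by fun_prop)))).aestronglyMeasurable
  · refine Eventually.of_forall fun y z _ ↦ ?_
    rw [norm_smul, LinearIsometryEquiv.norm_map, Real.norm_eq_abs]
    gcongr
    exact norm_gradKernel_le' hε _
  · exact (hf.abs.mul continuous_const).continuousOn.integrableOn_compact hA
  · refine Eventually.of_forall fun y z _ ↦ ?_
    have h := (hasGradientAt_log hε (z - y)).hasFDerivAt
    exact (h.comp z ((hasFDerivAt_id z).sub_const y)).const_mul (f y)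

lemma hasFDerivAt_gradPotential (hA : IsCompact A) (hf : Continuous f) (hε : 0 < ε) (x : Plane) :
    HasFDerivAt (gradPotential A f ε) (hessPotential A f ε x) x := by
  have hk : ∀ x, Continuous fun y ↦ f y • gradKernel ε (x - y) := fun x ↦
    hf.smul ((continuous_gradKernel hε).comp (by fun_prop))
  refine hasFDerivAt_integral_of_dominated_of_fderiv_le (𝕜 := ℝ) (s := univ)
    (F := fun x y ↦ f y • gradKernel ε (x - y)) (F' := fun x y ↦ f y • hessKernel ε (x - y))
    (bound := fun y ↦ |f y| * (3 * (ε ^ 2)⁻¹)) univ_mem ?_ ?_ ?_ ?_ ?_ ?_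
  · exact Eventually.of_forall fun x ↦ (hk x).aestronglyMeasurable
  · exact (hk x).continuousOn.integrableOn_compact hA
  · exact (hf.smul ((continuous_hessKernel hε).comp (by fun_prop))).aestronglyMeasurable
  · refine Eventually.of_forall fun y z _ ↦ ?_
    rw [norm_smul, Real.norm_eq_abs]
    gcongr
    exact norm_hessKernel_le' hε _
  · exact (hf.abs.mul continuous_const).continuousOn.integrableOn_compact hA
  · refine Eventually.of_forall fun y z _ ↦ ?_
    exact ((hasFDerivAt_gradKernel hε (z - y)).comp z
      ((hasFDerivAt_id z).sub_const y)).const_smul (f y)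

lemma continuous_hessPotential (hA : IsCompact A) (hf : Continuous f) (hε : 0 < ε) :
    Continuous (hessPotential A f ε) := by
  refine continuous_parametric_integral_of_continuous (f := fun x y ↦ f y • hessKernel ε (x - y))
    ?_ hA
  exact (hf.comp continuous_snd).smul ((continuous_hessKernel hε).comp (by fun_prop))

end regularized

section estimates

variable {A : Set Plane} {f : Plane → ℝ} {ε α M L r ρ : ℝ} {x : Plane}

lemma integrableOn_inv_norm_sub (hAx : A ⊆ Metric.ball x ρ) :
    IntegrableOn (fun y ↦ ‖x - y‖⁻¹) A := by
  have := integrableOn_norm_sub_rpow one_pos hAx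
  norm_num [Real.rpow_neg_one] at this
  exact this

lemma norm_gradKernel_smul_le (hM : ∀ y ∈ A, |f y| ≤ M) {y : Plane} (hy : y ∈ A) :
    ‖f y • gradKernel ε (x - y)‖ ≤ M * ‖x - y‖⁻¹ := by
  rw [norm_smul, Real.norm_eq_abs]
  exact mul_le_mul (hM y hy) (norm_gradKernel_le _ _) (norm_nonneg _)
    ((abs_nonneg _).trans (hM y hy))

lemma integrableOn_gradKernel (hA : MeasurableSet A) (hf : Continuous f)
    (hM : ∀ y ∈ A, |f y| ≤ M) (hAx : A ⊆ Metric.ball x ρ) :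
    IntegrableOn (fun y ↦ f y • gradKernel ε (x - y)) A := by
  refine ((integrableOn_inv_norm_sub hAx).const_mul M).mono' ?_ ?_
  · exact hf.aestronglyMeasurable.smul
      ((measurable_gradKernel ε).comp (by fun_prop)).aestronglyMeasurable
  · exact (ae_restrict_iff' hA).2 (Eventually.of_forall fun y hy ↦ norm_gradKernel_smul_le hM hy)

lemma norm_gradPotential_le (hA : MeasurableSet A) (hM : ∀ y ∈ A, |f y| ≤ M)
    (hAx : A ⊆ Metric.ball x ρ) : ‖gradPotential A f ε x‖ ≤ M * ∫ y in A, ‖x - y‖⁻¹ := by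
  rw [← integral_const_mul]
  refine norm_integral_le_of_norm_le ((integrableOn_inv_norm_sub hAx).const_mul M) ?_
  exact (ae_restrict_iff' hA).2 (Eventually.of_forall fun y hy ↦ norm_gradKernel_smul_le hM hy)

lemma gradPotential_sub {g : Plane → ℝ} {M' : ℝ} (hA : MeasurableSet A) (hf : Continuous f)
    (hg : Continuous g) (hM : ∀ y ∈ A, |f y| ≤ M) (hM' : ∀ y ∈ A, |g y| ≤ M')
    (hAx : A ⊆ Metric.ball x ρ) :
    gradPotential A f ε x - gradPotential A g ε x = gradPotential A (fun y ↦ f y - g y) ε x := by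
  rw [gradPotential, gradPotential, gradPotential,
    ← integral_sub (integrableOn_gradKernel hA hf hM hAx) (integrableOn_gradKernel hA hg hM' hAx)]
  simp_rw [sub_smul]

/-- The regularization error is `O(ε ^ θ)` for every `θ < 1`; the exponent `θ = 1 / 2` leaves the
integrable singularity `|x - y| ^ (-3 / 2)`. -/
lemma norm_gradPotential_sub_le (hA : MeasurableSet A) (hf : Continuous f)
    (hM : ∀ y ∈ A, |f y| ≤ M) (hM0 : 0 ≤ M) (hAx : A ⊆ Metric.ball x ρ) (hρ : 0 ≤ ρ)
    (hε : 0 < ε) :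
    ‖gradPotential A f ε x - gradPotential A f 0 x‖ ≤
      M * ε ^ (1 / 2 : ℝ) * (2 * Real.pi * (ρ ^ (1 / 2 : ℝ) / (1 / 2))) := by
  have hhalf : (0 : ℝ) < 1 / 2 := by norm_num
  rw [gradPotential, gradPotential,
    ← integral_sub (integrableOn_gradKernel hA hf hM hAx) (integrableOn_gradKernel hA hf hM hAx)]
  refine (norm_integral_le_of_norm_le
    ((integrableOn_norm_sub_rpow hhalf hAx).const_mul (M * ε ^ (1 / 2 : ℝ))) ?_).trans ?_
  · refine (ae_restrict_iff' hA).2 (Eventually.of_forall fun y hy ↦ ?_)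
    rw [← smul_sub, norm_smul, Real.norm_eq_abs, mul_assoc]
    refine mul_le_mul (hM y hy) ?_ (norm_nonneg _) hM0
    refine (norm_gradKernel_sub_le hε _).trans ?_
    rcases eq_or_ne (x - y) 0 with h | h
    · rw [h]; simp; positivity
    have h' : 0 < ‖x - y‖ := norm_pos_iff.2 h
    calc _ ≤ (ε / ‖x - y‖) ^ (1 / 2 : ℝ) * ‖x - y‖⁻¹ := by
          gcongr; exact sq_div_le_rpow hε hhalf.le (by norm_num) h'
      _ = _ := by
          rw [Real.div_rpow hε.le h'.le, div_eq_mul_inv, ← Real.rpow_neg h'.le,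
            ← Real.rpow_neg_one ‖x - y‖, mul_assoc, ← Real.rpow_add h']
          norm_num
  · rw [integral_const_mul]
    gcongr
    exact setIntegral_norm_sub_rpow_le hhalf hρ hAx

lemma tendsto_regularized_logPotential (hA : IsCompact A) (hf : Continuous f)
    (hM : ∀ y ∈ A, |f y| ≤ M) (hM0 : 0 ≤ M) (hAx : A ⊆ Metric.ball x ρ) {u : ℕ → ℝ}
    (hu : ∀ n, 0 < u n) (hu0 : Tendsto u atTop (𝓝 0)) :
    Tendsto (fun n ↦ ∫ y in A, f y * (Real.log (‖x - y‖ ^ 2 + u n ^ 2) / 2)) atTop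
      (𝓝 (logPotential A f x)) := by
  have hint : ∀ n, IntegrableOn (fun y ↦ f y * (Real.log (‖x - y‖ ^ 2 + u n ^ 2) / 2)) A := by
    intro n
    refine Continuous.continuousOn ?_ |>.integrableOn_compact hA
    have : ∀ y : Plane, ‖x - y‖ ^ 2 + u n ^ 2 ≠ 0 := fun y ↦ by have := hu n; positivity
    fun_prop (disch := assumption)
  -- At `y = x` the value `Real.log 0 = 0` is not the limit of the regularized values.
  have hae : ∀ᵐ y ∂(volume.restrict A), y ∈ A ∧ y ≠ x := by
    refine ((ae_restrict_iff' hA.measurableSet).2 (Eventually.of_forall fun _ h ↦ h)).and ?_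
    exact ae_restrict_of_ae (Measure.ae_ne volume x)
  have hbd : ∀ n, ∀ᵐ y ∂(volume.restrict A),
      ‖f y * (Real.log (‖x - y‖ ^ 2 + u n ^ 2) / 2) - f y * Real.log ‖x - y‖‖ ≤
        (M * u n) * ‖x - y‖⁻¹ := by
    intro n
    filter_upwards [hae] with y hy
    rw [← mul_sub, norm_mul, Real.norm_eq_abs, Real.norm_eq_abs, mul_assoc]
    refine mul_le_mul (hM y hy.1) ?_ (abs_nonneg _) hM0
    exact abs_log_regularized_sub_log_le (hu n) (norm_pos_iff.2 (sub_ne_zero.2 hy.2.symm))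
  have hmeas : AEStronglyMeasurable (fun y ↦ f y * Real.log ‖x - y‖) (volume.restrict A) := by
    apply Measurable.aestronglyMeasurable
    have := hf.measurable
    fun_prop
  have hdiff : ∀ n, IntegrableOn (fun y ↦ f y * (Real.log (‖x - y‖ ^ 2 + u n ^ 2) / 2) -
      f y * Real.log ‖x - y‖) A := fun n ↦
    ((integrableOn_inv_norm_sub hAx).const_mul (M * u n)).mono'
      ((hint n).aestronglyMeasurable.sub hmeas) (hbd n)
  have hlog : IntegrableOn (fun y ↦ f y * Real.log ‖x - y‖) A := by
    refine ((hint 0).sub (hdiff 0)).congr (Eventually.of_forall fun y ↦ ?_)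
    simp
  rw [tendsto_iff_norm_sub_tendsto_zero]
  refine squeeze_zero (g := fun n ↦ (M * u n) * ∫ y in A, ‖x - y‖⁻¹) (fun _ ↦ norm_nonneg _) ?_ ?_
  · intro n
    rw [logPotential, ← integral_sub (hint n) hlog, ← integral_const_mul]
    exact norm_integral_le_of_norm_le ((integrableOn_inv_norm_sub hAx).const_mul _) (hbd n)
  · simpa using (hu0.const_mul M).mul_const (∫ y in A, ‖x - y‖⁻¹)

lemma holder_const_nonneg (hH : ∀ x y, |f x - f y| ≤ L * ‖x - y‖ ^ α) : 0 ≤ L := by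
  simpa using (abs_nonneg _).trans (hH (EuclideanSpace.single 0 1) 0)

lemma norm_hessKernel_smul_le (hH : ∀ x y, |f x - f y| ≤ L * ‖x - y‖ ^ α)
    (x y : Plane) : ‖(f y - f x) • hessKernel ε (x - y)‖ ≤ 3 * L * ‖x - y‖ ^ (α - 2) := by
  rcases eq_or_ne x y with rfl | h
  · have : 0 ≤ L := holder_const_nonneg hH
    rw [sub_self, norm_smul, norm_zero, zero_mul]; positivity
  have h' : 0 < ‖x - y‖ := norm_pos_iff.2 (sub_ne_zero.2 h)
  rw [norm_smul, Real.norm_eq_abs]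
  calc _ ≤ (L * ‖x - y‖ ^ α) * (3 * (‖x - y‖ ^ 2)⁻¹) := by
        gcongr
        · exact (abs_nonneg _).trans (hH x y)
        · rw [abs_sub_comm]; exact hH x y
        · exact norm_hessKernel_le _ (sub_ne_zero.2 h)
    _ = _ := by
        rw [Real.rpow_sub h', Real.rpow_two]; ring

lemma integrableOn_sub_smul_hessKernel (hα : 0 < α) (hf : Continuous f)
    (hH : ∀ x y, |f x - f y| ≤ L * ‖x - y‖ ^ α) (hAx : A ⊆ Metric.ball x ρ) :
    IntegrableOn (fun y ↦ (f y - f x) • hessKernel ε (x - y)) A := by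
  refine ((integrableOn_norm_sub_rpow hα hAx).const_mul (3 * L)).mono' ?_ ?_
  · exact (hf.sub continuous_const).aestronglyMeasurable.smul
      ((stronglyMeasurable_hessKernel ε).comp_measurable (by fun_prop)).aestronglyMeasurable
  · exact Eventually.of_forall fun y ↦ norm_hessKernel_smul_le hH x y

lemma ne_zero_and_le_norm_sub_of_notMem_ball {y : Plane} (hr : 0 < r) (hy : y ∉ Metric.ball x r) :
    x - y ≠ 0 ∧ r ≤ ‖x - y‖ := by
  rw [Metric.mem_ball, dist_comm, dist_eq_norm, not_lt] at hy
  exact ⟨norm_pos_iff.1 (hr.trans_le hy), hy⟩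

lemma integrableOn_hessKernel_diff_ball (hA : IsCompact A) (hr : 0 < r) :
    IntegrableOn (fun y ↦ hessKernel ε (x - y)) (A \ Metric.ball x r) := by
  have hAm : MeasurableSet (A \ Metric.ball x r) :=
    hA.measurableSet.diff Metric.isOpen_ball.measurableSet
  refine IntegrableOn.of_bound (C := 3 * (r ^ 2)⁻¹)
    ((measure_mono sdiff_subset).trans_lt hA.measure_lt_top)
    ((stronglyMeasurable_hessKernel ε).comp_measurable (by fun_prop)).aestronglyMeasurable ?_
  refine (ae_restrict_iff' hAm).2 (Eventually.of_forall fun y hy ↦ ?_)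
  obtain ⟨h1, h2⟩ := ne_zero_and_le_norm_sub_of_notMem_ball hr hy.2
  refine (norm_hessKernel_le _ h1).trans ?_
  gcongr

/-- The decomposition that survives the limit `ε → 0`: the density is recentred at `x`, and the
constant part of the integral over the ball is computed exactly. -/
lemma hessPotential_eq (hA : IsCompact A) (hf : Continuous f) (hr : 0 < r)
    (hball : Metric.ball x r ⊆ A) (hε : 0 < ε) :
    hessPotential A f ε x = (∫ y in A, (f y - f x) • hessKernel ε (x - y)) +
      f x • ((∫ y in A \ Metric.ball x r, hessKernel ε (x - y)) +
        (Real.pi * (r ^ 2 / (r ^ 2 + ε ^ 2))) • ContinuousLinearMap.id ℝ Plane) := by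
  have hc : Continuous fun y ↦ hessKernel ε (x - y) :=
    (continuous_hessKernel hε).comp (by fun_prop)
  have hi : IntegrableOn (fun y ↦ hessKernel ε (x - y)) A := hc.continuousOn.integrableOn_compact hA
  have h1 : IntegrableOn (fun y ↦ (f y - f x) • hessKernel ε (x - y)) A :=
    ((hf.sub continuous_const).smul hc).continuousOn.integrableOn_compact hA
  rw [← setIntegral_ball_hessKernel hε hr.le, ← setIntegral_ball_comp_sub _ x,
    setIntegral_sdiff Metric.isOpen_ball.measurableSet hi hball, sub_add_cancel,
    ← integral_smul]
  refine Eq.trans ?_ (integral_add h1 (hi.smul (f x)))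
  refine integral_congr_ae (Eventually.of_forall fun y ↦ ?_)
  change _ = (f y - f x) • _ + f x • _
  module

/-- Spending half of the Hölder exponent on the factor `ε ^ (α / 2)` leaves the integrable
singularity `|x - y| ^ (α / 2 - 2)`. The bound is uniform in `x`. -/
lemma norm_hessPotential_sub_logHessian_le (hA : IsCompact A) (hf : Continuous f) (hα : 0 < α)
    (hα1 : α < 1) (hH : ∀ x y, |f x - f y| ≤ L * ‖x - y‖ ^ α) (hM : ∀ y, |f y| ≤ M)
    (hAx : A ⊆ Metric.ball x ρ) (hρ : 0 ≤ ρ) (hr : 0 < r) (hball : Metric.ball x r ⊆ A)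
    (hε : 0 < ε) :
    ‖hessPotential A f ε x - logHessian A f r x‖ ≤
      5 * L * ε ^ (α / 2) * (2 * Real.pi * (ρ ^ (α / 2) / (α / 2))) +
        M * (5 * ε ^ 2 / r ^ 4 * volume.real A + Real.pi * (ε ^ 2 / r ^ 2)) := by
  have hM0 : 0 ≤ M := (abs_nonneg _).trans (hM 0)
  have hα2 : 0 < α / 2 := by positivity
  have hL : 0 ≤ L := holder_const_nonneg hH
  have hsplit : ∀ (P P' Q Q' T : Plane →L[ℝ] Plane) (a p q : ℝ),
      P + a • (Q + p • T) - (P' + a • (Q' + q • T)) = P - P' + a • (Q - Q' + (p - q) • T) := by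
    intros; module
  rw [hessPotential_eq hA hf hr hball hε, logHessian, hsplit]
  refine (norm_add_le _ _).trans (add_le_add ?_ ?_)
  · rw [← integral_sub (integrableOn_sub_smul_hessKernel hα hf hH hAx)
      (integrableOn_sub_smul_hessKernel hα hf hH hAx)]
    refine (norm_integral_le_of_norm_le
      ((integrableOn_norm_sub_rpow hα2 hAx).const_mul (5 * L * ε ^ (α / 2))) ?_).trans ?_
    · refine Eventually.of_forall fun y ↦ ?_
      rw [show (f y - f x) • hessKernel ε (x - y) - (f y - f x) • hessKernel 0 (x - y) =
        (f y - f x) • (hessKernel ε (x - y) - hessKernel 0 (x - y)) by module, norm_smul,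
        Real.norm_eq_abs]
      rcases eq_or_ne x y with rfl | h
      · simp; positivity
      have h' : 0 < ‖x - y‖ := norm_pos_iff.2 (sub_ne_zero.2 h)
      calc _ ≤ (L * ‖x - y‖ ^ α) * (5 * (ε / ‖x - y‖) ^ (α / 2) * (‖x - y‖ ^ 2)⁻¹) := by
            gcongr
            · rw [abs_sub_comm]; exact hH x y
            · refine (norm_hessKernel_sub_le hε (sub_ne_zero.2 h)).trans ?_
              gcongr
              exact sq_div_le_rpow hε hα2.le (by linarith) h'
        _ = 5 * L * ε ^ (α / 2) * (‖x - y‖ ^ α / ‖x - y‖ ^ (α / 2) / ‖x - y‖ ^ (2 : ℝ)) := by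
            rw [Real.div_rpow hε.le h'.le, Real.rpow_two]; ring
        _ = _ := by
            rw [← Real.rpow_sub h', ← Real.rpow_sub h']; ring_nf
    · rw [integral_const_mul]
      gcongr
      exact setIntegral_norm_sub_rpow_le hα2 hρ hAx
  · rw [norm_smul, Real.norm_eq_abs]
    refine mul_le_mul (hM x) ?_ (norm_nonneg _) hM0
    refine (norm_add_le _ _).trans (add_le_add ?_ ?_)
    · rw [← integral_sub (integrableOn_hessKernel_diff_ball hA hr)
        (integrableOn_hessKernel_diff_ball hA hr)]
      refine (norm_setIntegral_le_of_norm_le_const (C := 5 * ε ^ 2 / r ^ 4)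
        ((measure_mono sdiff_subset).trans_lt hA.measure_lt_top) fun y hy ↦ ?_).trans ?_
      · obtain ⟨h1, h2⟩ := ne_zero_and_le_norm_sub_of_notMem_ball hr hy.2
        refine (norm_hessKernel_sub_le hε h1).trans ?_
        calc _ ≤ 5 * (ε ^ 2 / r ^ 2) * (r ^ 2)⁻¹ := by
              gcongr
              nlinarith [sq_nonneg ε]
          _ = _ := by field_simp
      · gcongr
        · exact hA.measure_lt_top.ne
        · exact sdiff_subset
    · rw [norm_smul, ContinuousLinearMap.norm_id, mul_one, Real.norm_eq_abs,
        show Real.pi * (r ^ 2 / (r ^ 2 + ε ^ 2)) - Real.pi =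
          -(Real.pi * (ε ^ 2 / (r ^ 2 + ε ^ 2))) by field_simp; ring, abs_neg,
        abs_of_nonneg (by positivity)]
      gcongr
      nlinarith [sq_nonneg ε]

end estimates

section limit

variable {A : Set Plane} {f : Plane → ℝ} {α M L r : ℝ} {x₀ : Plane}

/-- The classical interior regularity of the logarithmic potential of a Hölder density. -/
theorem logPotential_regularity (hA : IsCompact A) (hf : Continuous f) (hα : 0 < α)
    (hα1 : α < 1) (hH : ∀ x y, |f x - f y| ≤ L * ‖x - y‖ ^ α) (hM : ∀ y, |f y| ≤ M)
    (hr : 0 < r) (hball : Metric.closedBall x₀ (2 * r) ⊆ A) :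
    (∀ x ∈ Metric.ball x₀ r, HasGradientAt (logPotential A f) (gradPotential A f 0 x) x) ∧
    (∀ x ∈ Metric.ball x₀ r, HasFDerivAt (gradPotential A f 0) (logHessian A f r x) x) ∧
    ContinuousOn (logHessian A f r) (Metric.ball x₀ r) := by
  have hM0 : 0 ≤ M := (abs_nonneg _).trans (hM 0)
  obtain ⟨ρ₀, hρ₀⟩ := hA.isBounded.subset_closedBall x₀
  set ρ := |ρ₀| + r + 1 with hρdef
  have hρ : 0 ≤ ρ := by positivity
  have hAx : ∀ x ∈ Metric.ball x₀ r, A ⊆ Metric.ball x ρ := by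
    intro x hx y hy
    have h1 := Metric.mem_closedBall.1 (hρ₀ hy)
    have h2 := Metric.mem_ball'.1 hx
    have := dist_triangle y x₀ x
    rw [Metric.mem_ball]
    linarith [le_abs_self ρ₀]
  have hballx : ∀ x ∈ Metric.ball x₀ r, Metric.ball x r ⊆ A := by
    intro x hx y hy
    refine hball ?_
    have := dist_triangle y x x₀
    rw [Metric.mem_ball] at hx hy
    rw [Metric.mem_closedBall]
    linarith
  set u : ℕ → ℝ := fun n ↦ 1 / ((n : ℝ) + 1) with hu_def
  have hu : ∀ n, 0 < u n := fun n ↦ by positivity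
  have hu0 : Tendsto u atTop (𝓝 0) := tendsto_one_div_add_atTop_nhds_zero_nat
  have hpow : ∀ θ : ℝ, 0 < θ → Tendsto (fun n ↦ u n ^ θ) atTop (𝓝 0) := fun θ hθ ↦ by
    simpa [Real.zero_rpow hθ.ne'] using hu0.rpow_const (p := θ) (Or.inr hθ.le)
  have hu2 : Tendsto (fun n ↦ u n ^ 2) atTop (𝓝 0) := by simpa using hu0.pow 2
  have hunif : TendstoUniformlyOn (fun n ↦ gradPotential A f (u n)) (gradPotential A f 0) atTop
      (Metric.ball x₀ r) := by
    rw [Metric.tendstoUniformlyOn_iff]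
    intro δ hδ
    have hlim : Tendsto (fun n ↦ M * u n ^ (1 / 2 : ℝ) *
        (2 * Real.pi * (ρ ^ (1 / 2 : ℝ) / (1 / 2)))) atTop (𝓝 0) := by
      simpa using ((hpow (1 / 2) (by norm_num)).const_mul M).mul_const
        (2 * Real.pi * (ρ ^ (1 / 2 : ℝ) / (1 / 2)))
    filter_upwards [hlim.eventually_lt_const hδ] with n hn x hx
    rw [dist_comm, dist_eq_norm]
    exact (norm_gradPotential_sub_le hA.measurableSet hf (fun y _ ↦ hM y) hM0 (hAx x hx) hρ
      (hu n)).trans_lt hn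
  have hunif2 : TendstoUniformlyOn (fun n ↦ hessPotential A f (u n)) (logHessian A f r) atTop
      (Metric.ball x₀ r) := by
    rw [Metric.tendstoUniformlyOn_iff]
    intro δ hδ
    have hlim : Tendsto (fun n ↦ 5 * L * u n ^ (α / 2) *
        (2 * Real.pi * (ρ ^ (α / 2) / (α / 2))) +
        M * (5 * u n ^ 2 / r ^ 4 * volume.real A + Real.pi * (u n ^ 2 / r ^ 2))) atTop (𝓝 0) := by
      have h1 := ((hpow (α / 2) (by positivity)).const_mul (5 * L)).mul_const
        (2 * Real.pi * (ρ ^ (α / 2) / (α / 2)))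
      have h2 := ((((hu2.const_mul 5).div_const (r ^ 4)).mul_const (volume.real A)).add
        ((hu2.div_const (r ^ 2)).const_mul Real.pi)).const_mul M
      simpa using h1.add h2
    filter_upwards [hlim.eventually_lt_const hδ] with n hn x hx
    rw [dist_comm, dist_eq_norm]
    exact (norm_hessPotential_sub_logHessian_le hA hf hα hα1 hH hM (hAx x hx) hρ hr
      (hballx x hx) (hu n)).trans_lt hn
  refine ⟨fun x hx ↦ ?_, fun x hx ↦ ?_, ?_⟩
  · rw [hasGradientAt_iff_hasFDerivAt]
    refine hasFDerivAt_of_tendstoUniformlyOn (l := atTop) (s := Metric.ball x₀ r)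
      (g' := fun x ↦ (InnerProductSpace.toDual ℝ Plane) (gradPotential A f 0 x))
      Metric.isOpen_ball ((InnerProductSpace.toDual ℝ Plane).isometry.uniformContinuous
        |>.comp_tendstoUniformlyOn hunif)
      (fun n x _ ↦ (hasGradientAt_regularized_logPotential hA hf (hu n) x).hasFDerivAt)
      (fun x hx ↦ tendsto_regularized_logPotential hA hf (fun y _ ↦ hM y) hM0 (hAx x hx) hu hu0)
      hx
  · exact hasFDerivAt_of_tendstoUniformlyOn Metric.isOpen_ball hunif2
      (fun n x _ ↦ hasFDerivAt_gradPotential hA hf (hu n) x)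
      (fun x hx ↦ hunif.tendsto_at hx) hx
  · exact hunif2.continuousOn
      (Frequently.of_forall fun n ↦ (continuous_hessPotential hA hf (hu n)).continuousOn)

end limit

section logHessian

variable {A : Set Plane} {f : Plane → ℝ} {α M L r ρ : ℝ} {x : Plane}

/-- Only the mass carried by the ball contributes to the Laplacian of the potential. -/
lemma logHessian_trace (hA : IsCompact A) (hf : Continuous f) (hα : 0 < α)
    (hH : ∀ x y, |f x - f y| ≤ L * ‖x - y‖ ^ α) (hr : 0 < r) (x : Plane) :
    (logHessian A f r x (EuclideanSpace.single 0 1)) 0 +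
      (logHessian A f r x (EuclideanSpace.single 1 1)) 1 = 2 * Real.pi * f x := by
  obtain ⟨ρ, hρ⟩ := hA.isBounded.subset_ball x
  -- The trace as a continuous linear functional.
  let T : (Plane →L[ℝ] Plane) →L[ℝ] ℝ :=
    (EuclideanSpace.proj (0 : Fin 2)).comp
      (ContinuousLinearMap.apply ℝ Plane (EuclideanSpace.single (0 : Fin 2) (1 : ℝ))) +
    (EuclideanSpace.proj (1 : Fin 2)).comp
      (ContinuousLinearMap.apply ℝ Plane (EuclideanSpace.single (1 : Fin 2) (1 : ℝ)))
  have hT : ∀ B : Plane →L[ℝ] Plane, T B =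
      (B (EuclideanSpace.single 0 1)) 0 + (B (EuclideanSpace.single 1 1)) 1 := fun B ↦ rfl
  have hT0 : ∀ z, T (hessKernel 0 z) = 0 := fun z ↦ (hT _).trans (hessKernel_zero_trace z)
  rw [← hT, logHessian, map_add, map_smul, map_add, map_smul,
    ← T.integral_comp_comm (integrableOn_sub_smul_hessKernel hα hf hH hρ),
    ← T.integral_comp_comm (integrableOn_hessKernel_diff_ball hA hr)]
  simp_rw [map_smul, hT0, hT]
  simp
  ring

lemma norm_logHessian_le (hA : IsCompact A) (hα : 0 < α)
    (hH : ∀ x y, |f x - f y| ≤ L * ‖x - y‖ ^ α) (hM : ∀ y, |f y| ≤ M)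
    (hAx : A ⊆ Metric.ball x ρ) (hρ : 0 ≤ ρ) (hr : 0 < r) {D : ℝ}
    (hDi : IntegrableOn (fun y ↦ (‖x - y‖ ^ 2)⁻¹) (A \ Metric.ball x r))
    (hD : ∫ y in A \ Metric.ball x r, (‖x - y‖ ^ 2)⁻¹ ≤ D) :
    ‖logHessian A f r x‖ ≤
      3 * L * (2 * Real.pi * (ρ ^ α / α)) + M * (3 * D + Real.pi) := by
  have hM0 : 0 ≤ M := (abs_nonneg _).trans (hM 0)
  have hL : 0 ≤ L := holder_const_nonneg hH
  refine (norm_add_le _ _).trans (add_le_add ?_ ?_)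
  · refine (norm_integral_le_of_norm_le
      ((integrableOn_norm_sub_rpow hα hAx).const_mul (3 * L))
      (Eventually.of_forall fun y ↦ norm_hessKernel_smul_le hH x y)).trans ?_
    rw [integral_const_mul]
    gcongr
    exact setIntegral_norm_sub_rpow_le hα hρ hAx
  · rw [norm_smul, Real.norm_eq_abs]
    refine mul_le_mul (hM x) ?_ (norm_nonneg _) hM0
    refine (norm_add_le _ _).trans (add_le_add ?_ ?_)
    · refine (norm_integral_le_of_norm_le (hDi.const_mul 3) ?_).trans ?_
      · refine (ae_restrict_iff' (hA.measurableSet.diff Metric.isOpen_ball.measurableSet)).2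
          (Eventually.of_forall fun y hy ↦ ?_)
        exact norm_hessKernel_le _ (ne_zero_and_le_norm_sub_of_notMem_ball hr hy.2).1
      · rw [integral_const_mul]
        gcongr
    · rw [norm_smul, ContinuousLinearMap.norm_id, mul_one, Real.norm_of_nonneg Real.pi_nonneg]

end logHessian

/-! ### Integrals over thin tubes -/

open scoped ENNReal

namespace IsCenterline

variable {c : ℝ → Plane}

lemma dist_le (hc : IsCenterline c) (s t : ℝ) : dist (c s) (c t) ≤ |s - t| := by
  have h : LipschitzWith 1 c := lipschitzWith_of_nnnorm_deriv_le
    (fun t ↦ (hc.hasDerivAt t).differentiableAt) fun t ↦ by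
      rw [← NNReal.coe_le_coe]; simp [hc.unit_speed t]
  simpa [Real.dist_eq] using h.dist_le_mul s t

/-- On short parameter intervals, chords are at least half as long as arcs. -/
lemma exists_half_abs_le_dist (hc : IsCenterline c) (T : ℝ) :
    ∃ δ > 0, ∀ s ∈ Icc 0 T, ∀ t ∈ Icc 0 T, |t - s| ≤ δ → |t - s| / 2 ≤ dist (c t) (c s) := by
  have hcont : Continuous (deriv c) := hc.contDiff.continuous_deriv (by norm_num)
  have huc := isCompact_Icc.uniformContinuousOn_of_continuous (hcont.continuousOn (s := Icc 0 T))
  obtain ⟨δ, hδ, h⟩ := Metric.uniformContinuousOn_iff.1 huc (1 / 2) (by norm_num)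
  refine ⟨δ / 2, by positivity, fun s hs t ht hst ↦ ?_⟩
  have hsub : uIcc s t ⊆ Icc 0 T := uIcc_subset_Icc hs ht
  have h1 : ‖(c t - t • deriv c s) - (c s - s • deriv c s)‖ ≤ 1 / 2 * ‖t - s‖ := by
    refine (convex_uIcc s t).norm_image_sub_le_of_norm_hasDerivWithin_le
      (f := fun t ↦ c t - t • deriv c s) (f' := fun t ↦ deriv c t - deriv c s) ?_ ?_
      left_mem_uIcc right_mem_uIcc
    · intro t _
      have := (hc.hasDerivAt t).sub ((hasDerivAt_id t).smul_const (deriv c s))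
      rw [one_smul] at this
      exact this.hasDerivWithinAt
    · intro u hu
      have h2 : dist u s < δ := by
        rw [Real.dist_eq]
        refine lt_of_le_of_lt ?_ (show δ / 2 < δ by linarith)
        exact (abs_sub_left_of_mem_uIcc hu).trans hst
      rw [← dist_eq_norm]
      exact (h u (hsub hu) s hs h2).le
  have h3 : (c t - t • deriv c s) - (c s - s • deriv c s) = (c t - c s) - (t - s) • deriv c s := by
    rw [sub_smul]; abel
  rw [h3] at h1
  have h4 : ‖(t - s) • deriv c s‖ = |t - s| := by
    rw [norm_smul, hc.unit_speed, mul_one, Real.norm_eq_abs]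
  have h5 := norm_sub_norm_le ((t - s) • deriv c s) (c t - c s)
  rw [norm_sub_rev ((t - s) • deriv c s), h4] at h5
  rw [Real.norm_eq_abs] at h1
  rw [dist_eq_norm]
  linarith

/-- Along a short arc, the distance to `x` grows at least linearly away from the point of the arc
nearest to `x`. -/
lemma lintegral_short_arc_le (hc : IsCenterline c) {T δ a b : ℝ}
    (hδ : ∀ s ∈ Icc 0 T, ∀ t ∈ Icc 0 T, |t - s| ≤ δ → |t - s| / 2 ≤ dist (c t) (c s))
    (ha : 0 ≤ a) (hab : a ≤ b) (hb : b ≤ T) (hba : b - a ≤ δ) {h : ℝ → ℝ≥0∞} (hh : Antitone h)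
    {U : ℝ} (hU : 0 < U) (x : Plane) :
    ∫⁻ t in Icc a b, h (U + ‖c t - x‖) ≤ 2 * ∫⁻ s in Icc 0 T, h ((U + s) / 4) := by
  obtain ⟨m, hm, hmin⟩ := isCompact_Icc.exists_isMinOn (nonempty_Icc.2 hab)
    (f := fun t ↦ ‖c t - x‖) ((hc.continuous.sub continuous_const).norm.continuousOn)
  -- The integrand is dominated by a one-sided profile and its reflection, both centred at `m`.
  set G : ℝ → ℝ≥0∞ := (Icc 0 T).indicator fun s ↦ h ((U + s) / 4) with hG
  have hGm : Measurable G :=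
    (hh.measurable.comp (by fun_prop : Measurable fun s : ℝ ↦ (U + s) / 4)).indicator
      measurableSet_Icc
  have hle : ∀ t ∈ Icc a b, h (U + ‖c t - x‖) ≤ G (t - m) + G (m - t) := by
    intro t ht
    have h1 : |t - m| ≤ b - a := abs_le.2 ⟨by linarith [ht.1, hm.2], by linarith [ht.2, hm.1]⟩
    have h2 := hδ m ⟨by linarith [hm.1], by linarith [hm.2]⟩ t
      ⟨by linarith [ht.1], by linarith [ht.2]⟩ (h1.trans hba)
    have h3 : dist (c t) (c m) ≤ ‖c t - x‖ + ‖c m - x‖ := by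
      rw [← dist_eq_norm, ← dist_eq_norm]; exact dist_triangle_right _ _ _
    have h4 : ‖c m - x‖ ≤ ‖c t - x‖ := hmin ht
    have h5 : h (U + ‖c t - x‖) ≤ h ((U + |t - m|) / 4) := hh (by linarith)
    have h6 : |t - m| ≤ T := by linarith
    refine h5.trans ?_
    rcases le_total m t with h7 | h7
    · rw [abs_of_nonneg (by linarith)] at h6 ⊢
      refine le_trans ?_ le_self_add
      rw [hG, indicator_of_mem (show t - m ∈ Icc 0 T from ⟨by linarith, h6⟩)]
    · rw [abs_of_nonpos (by linarith), neg_sub] at h6 ⊢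
      refine le_trans ?_ le_add_self
      rw [hG, indicator_of_mem (show m - t ∈ Icc 0 T from ⟨by linarith, h6⟩)]
  calc ∫⁻ t in Icc a b, h (U + ‖c t - x‖)
      ≤ ∫⁻ t in Icc a b, (G (t - m) + G (m - t)) := setLIntegral_mono' measurableSet_Icc hle
    _ ≤ ∫⁻ t, (G (t - m) + G (m - t)) := setLIntegral_le_lintegral _ _
    _ = 2 * ∫⁻ s, G s := by
        rw [lintegral_add_left (f := fun t ↦ G (t - m)) (hGm.comp (by fun_prop)),
          lintegral_sub_right_eq_self, lintegral_sub_left_eq_self, two_mul]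
    _ = _ := by rw [hG, lintegral_indicator measurableSet_Icc]

/-- The curve consists of finitely many short arcs, so line integrals of decreasing functions of the
distance to `x` are controlled by integrals on an interval, uniformly in `x`. -/
lemma exists_lintegral_curve_le (hc : IsCenterline c) {T : ℝ} (hT : 0 < T) :
    ∃ N : ℕ, ∀ h : ℝ → ℝ≥0∞, Antitone h → ∀ U > 0, ∀ x : Plane,
      ∫⁻ t in Icc 0 T, h (U + ‖c t - x‖) ≤ N * (2 * ∫⁻ s in Icc 0 T, h ((U + s) / 4)) := by
  obtain ⟨δ, hδ0, hδ⟩ := hc.exists_half_abs_le_dist T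
  obtain ⟨N, hN⟩ := exists_nat_gt (T / δ)
  have hN0 : (0 : ℝ) < N := (by positivity : 0 < T / δ).trans hN
  have hd : T / N ≤ δ := by
    rw [div_le_iff₀ hN0]; rw [div_lt_iff₀ hδ0] at hN; linarith
  have hd0 : 0 < T / N := by positivity
  refine ⟨N, fun h hh U hU x ↦ ?_⟩
  have hcover : Icc 0 T ⊆ ⋃ i : Fin N, Icc ((i : ℝ) * (T / N)) (((i : ℝ) + 1) * (T / N)) := by
    intro t ht
    rw [mem_iUnion]
    rcases eq_or_lt_of_le ht.2 with rfl | htT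
    · obtain ⟨k, rfl⟩ : ∃ k, N = k + 1 :=
        Nat.exists_eq_succ_of_ne_zero (by rintro rfl; simp at hN0)
      refine ⟨Fin.last k, ?_, ?_⟩
      · rw [Fin.val_last, mul_div_assoc', div_le_iff₀ hN0]
        push_cast
        nlinarith
      · rw [Fin.val_last, mul_div_assoc', le_div_iff₀ hN0]
        push_cast
        nlinarith
    · have h0 : 0 ≤ t / (T / N) := div_nonneg ht.1 hd0.le
      have hlt : ⌊t / (T / N)⌋₊ < N := by
        rw [Nat.floor_lt h0, div_lt_iff₀ hd0]
        rwa [mul_div_cancel₀ _ hN0.ne']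
      refine ⟨⟨_, hlt⟩, ?_, ?_⟩
      · exact (le_div_iff₀ hd0).1 (Nat.floor_le h0)
      · exact (div_le_iff₀ hd0).1 (Nat.lt_floor_add_one _).le
  calc ∫⁻ t in Icc 0 T, h (U + ‖c t - x‖)
      ≤ ∫⁻ t in ⋃ i : Fin N, Icc ((i : ℝ) * (T / N)) (((i : ℝ) + 1) * (T / N)),
          h (U + ‖c t - x‖) := lintegral_mono_set hcover
    _ ≤ ∑' i : Fin N, ∫⁻ t in Icc ((i : ℝ) * (T / N)) (((i : ℝ) + 1) * (T / N)),
          h (U + ‖c t - x‖) := lintegral_iUnion_le _ _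
    _ ≤ ∑' _ : Fin N, 2 * ∫⁻ s in Icc 0 T, h ((U + s) / 4) := by
        refine ENNReal.tsum_le_tsum fun i ↦ ?_
        have hi : ((i : ℝ) + 1) ≤ N := by exact_mod_cast i.2
        refine hc.lintegral_short_arc_le hδ (by positivity) (by nlinarith) ?_ (by linarith) hh hU x
        calc ((i : ℝ) + 1) * (T / N) ≤ N * (T / N) := by gcongr
          _ = T := mul_div_cancel₀ _ hN0.ne'
    _ = _ := by simp

/-- Integrals over a thin tube, away from a ball of comparable radius, reduce to integrals along
the curve: `tube c (2 * U)` is swept by the discs of radius `3 * U` centred on the curve, and every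
point of it lies in the discs of a parameter interval of length `U`. -/
lemma lintegral_tube_le (hc : IsCenterline c) {U U₀ : ℝ} (hU : 0 < U) (hU₀ : U ≤ U₀)
    {h : ℝ → ℝ≥0∞} (hh : Antitone h) (x : Plane) :
    ∫⁻ y in tube c (2 * U) \ Metric.ball x (U / 2), h ‖x - y‖ ≤
      ENNReal.ofReal (9 * Real.pi * U) *
        ∫⁻ t in Icc 0 (1 + U₀), h ((U + ‖c t - x‖) / 9) := by
  set B := tube c (2 * U) \ Metric.ball x (U / 2) with hB
  have hBm : MeasurableSet B :=
    (hc.isCompact_tube _).measurableSet.diff Metric.isOpen_ball.measurableSet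
  set P : Set (Plane × ℝ) := {p | dist p.1 (c p.2) ≤ 3 * U} with hP
  set F : Plane × ℝ → ℝ≥0∞ := P.indicator fun p ↦ h ((U + ‖c p.2 - x‖) / 9) with hF
  have hcc := hc.continuous
  have hhm : Measurable fun t ↦ h ((U + ‖c t - x‖) / 9) :=
    hh.measurable.comp (by fun_prop : Continuous fun t ↦ (U + ‖c t - x‖) / 9).measurable
  have hFm : Measurable F := by
    refine (hhm.comp measurable_snd).indicator ?_
    exact (isClosed_le (by fun_prop) continuous_const).measurableSet
  have hpt : ∀ y ∈ B, ENNReal.ofReal U * h ‖x - y‖ ≤ ∫⁻ t in Icc 0 (1 + U₀), F (y, t) := by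
    rintro y ⟨hy, hyx⟩
    obtain ⟨t₀, ht₀, hyt⟩ := hc.mem_tube_iff.1 hy
    have hyx' : U / 2 ≤ ‖x - y‖ := by
      rw [Metric.mem_ball', not_lt, dist_eq_norm] at hyx; exact hyx
    have hsub : Icc t₀ (t₀ + U) ⊆ Icc 0 (1 + U₀) :=
      Icc_subset_Icc ht₀.1 (by linarith [ht₀.2])
    calc ENNReal.ofReal U * h ‖x - y‖ = ∫⁻ _ in Icc t₀ (t₀ + U), h ‖x - y‖ := by
          rw [setLIntegral_const, Real.volume_Icc, add_sub_cancel_left, mul_comm]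
      _ ≤ ∫⁻ t in Icc t₀ (t₀ + U), F (y, t) := by
          refine setLIntegral_mono' measurableSet_Icc fun t ht ↦ ?_
          have h1 : dist (c t₀) (c t) ≤ U := (hc.dist_le t₀ t).trans
            (abs_le.2 ⟨by linarith [ht.2], by linarith [ht.1]⟩)
          have h2 : dist y (c t) ≤ 3 * U := by linarith [dist_triangle y (c t₀) (c t)]
          rw [hF, indicator_of_mem (show (y, t) ∈ P from h2)]
          -- `U + |c t - x| ≤ 4 U + |x - y| ≤ 9 |x - y|`, since `U ≤ 2 |x - y|`.
          refine hh ?_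
          have h3 : ‖c t - x‖ ≤ dist y (c t) + ‖x - y‖ := by
            rw [← dist_eq_norm, ← dist_eq_norm, dist_comm y, dist_comm x]
            exact dist_triangle _ _ _
          show (U + ‖c t - x‖) / 9 ≤ _
          linarith
      _ ≤ _ := lintegral_mono_set hsub
  have hball : ∀ t, ∫⁻ y, F (y, t) =
      ENNReal.ofReal U * (ENNReal.ofReal (9 * Real.pi * U) * h ((U + ‖c t - x‖) / 9)) := by
    intro t
    have : (fun y ↦ F (y, t)) =
        (Metric.closedBall (c t) (3 * U)).indicator fun _ ↦ h ((U + ‖c t - x‖) / 9) := by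
      ext y
      simp only [hF, hP, indicator, mem_ofPred_eq, Metric.mem_closedBall]
    rw [this, lintegral_indicator Metric.isClosed_closedBall.measurableSet, setLIntegral_const,
      EuclideanSpace.volume_closedBall_fin_two, ← ENNReal.ofReal_pow (by positivity),
      ← ENNReal.ofReal_mul (by positivity), ← mul_assoc, ← ENNReal.ofReal_mul hU.le, mul_comm]
    congr 2
    ring
  -- The common factor `U` is kept on both sides so that Tonelli's theorem applies, then cancelled.
  have hmain : ENNReal.ofReal U * ∫⁻ y in B, h ‖x - y‖ ≤ ENNReal.ofReal U *
      (ENNReal.ofReal (9 * Real.pi * U) *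
        ∫⁻ t in Icc 0 (1 + U₀), h ((U + ‖c t - x‖) / 9)) := by
    calc _ = ∫⁻ y in B, ENNReal.ofReal U * h ‖x - y‖ :=
          (lintegral_const_mul' _ _ ENNReal.ofReal_ne_top).symm
      _ ≤ ∫⁻ y in B, ∫⁻ t in Icc 0 (1 + U₀), F (y, t) := setLIntegral_mono' hBm hpt
      _ ≤ ∫⁻ y, ∫⁻ t in Icc 0 (1 + U₀), F (y, t) := setLIntegral_le_lintegral _ _
      _ = ∫⁻ t in Icc 0 (1 + U₀), ∫⁻ y, F (y, t) :=
          lintegral_lintegral_swap (f := fun y t ↦ F (y, t)) hFm.aemeasurable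
      _ = _ := by
          simp_rw [hball]
          rw [lintegral_const_mul' _ _ ENNReal.ofReal_ne_top,
            lintegral_const_mul' _ _ ENNReal.ofReal_ne_top]
  rwa [ENNReal.mul_le_mul_iff_right (by simpa using hU) ENNReal.ofReal_ne_top] at hmain

end IsCenterline

lemma lintegral_Icc_ofReal_eq_sub {F g : ℝ → ℝ} {T : ℝ} (hT : 0 ≤ T)
    (hF : ∀ s ∈ Icc 0 T, HasDerivAt F (g s) s) (hg : ContinuousOn g (Icc 0 T))
    (hg0 : ∀ s ∈ Icc 0 T, 0 ≤ g s) :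
    ∫⁻ s in Icc 0 T, ENNReal.ofReal (g s) = ENNReal.ofReal (F T - F 0) := by
  rw [← uIcc_of_le hT] at hF hg
  rw [← intervalIntegral.integral_eq_sub_of_hasDerivAt hF hg.intervalIntegrable,
    intervalIntegral.integral_of_le hT, ← integral_Icc_eq_integral_Ioc,
    ofReal_integral_eq_lintegral_ofReal]
  · rw [uIcc_of_le hT] at hg
    exact hg.integrableOn_compact isCompact_Icc
  · exact (ae_restrict_iff' measurableSet_Icc).2 (Eventually.of_forall hg0)

lemma integrableOn_and_integral_le_of_lintegral_le {B : Set Plane} {g : Plane → ℝ} {C : ℝ}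
    (hg : Measurable g) (hg0 : ∀ y, 0 ≤ g y) (hC : 0 ≤ C)
    (h : ∫⁻ y in B, ENNReal.ofReal (g y) ≤ ENNReal.ofReal C) :
    IntegrableOn g B ∧ ∫ y in B, g y ≤ C := by
  have hae : 0 ≤ᵐ[volume.restrict B] g := Eventually.of_forall hg0
  refine ⟨⟨hg.aestronglyMeasurable, ?_⟩, ?_⟩
  · rw [hasFiniteIntegral_iff_ofReal hae]
    exact h.trans_lt ENNReal.ofReal_lt_top
  · rw [integral_eq_lintegral_of_nonneg_ae hae hg.aestronglyMeasurable]
    exact ENNReal.toReal_le_of_le_ofReal hC h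

lemma antitone_inv_ofReal : Antitone fun s : ℝ ↦ (ENNReal.ofReal s)⁻¹ :=
  fun _ _ h ↦ ENNReal.inv_le_inv.2 (ENNReal.ofReal_le_ofReal h)

lemma antitone_inv_ofReal_sq : Antitone fun s : ℝ ↦ ((ENNReal.ofReal s) ^ 2)⁻¹ :=
  fun _ _ h ↦ ENNReal.inv_le_inv.2 (pow_le_pow_left' (ENNReal.ofReal_le_ofReal h) 2)

namespace IsCenterline

variable {c : ℝ → Plane}

/-- On a thin tube, away from a disc of radius `U / 2`, the singular kernels of orders one and two
have integrals of the order of `U (1 + |ln U|)` and `1`. -/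
lemma exists_integral_tube_le (hc : IsCenterline c) {U₀ : ℝ} (hU₀ : 0 < U₀) :
    ∃ C, 0 ≤ C ∧ ∀ U, 0 < U → U ≤ U₀ → ∀ x : Plane,
      (IntegrableOn (fun y ↦ (‖x - y‖ ^ 2)⁻¹) (tube c (2 * U) \ Metric.ball x (U / 2)) ∧
        ∫ y in tube c (2 * U) \ Metric.ball x (U / 2), (‖x - y‖ ^ 2)⁻¹ ≤ C) ∧
      ∫ y in tube c (2 * U) \ Metric.ball x (U / 2), ‖x - y‖⁻¹ ≤
        C * (U * (1 + |Real.log U|)) := by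
  set T := 1 + U₀ with hT
  have hT0 : 0 < T := by positivity
  obtain ⟨N, hN⟩ := hc.exists_lintegral_curve_le hT0
  have hred : ∀ h : ℝ → ℝ≥0∞, Antitone h → ∀ U, 0 < U → U ≤ U₀ → ∀ x : Plane,
      ∫⁻ y in tube c (2 * U) \ Metric.ball x (U / 2), h ‖x - y‖ ≤
        ENNReal.ofReal (18 * Real.pi * N * U) * ∫⁻ s in Icc 0 T, h ((U + s) / 36) := by
    intro h hh U hU hUU x
    refine (hc.lintegral_tube_le hU hUU hh x).trans ?_
    have hh9 : Antitone fun s ↦ h (s / 9) := fun a b hab ↦ hh (by linarith)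
    have h36 : ∀ s, (U + s) / 4 / 9 = (U + s) / 36 := fun s ↦ by ring
    have := hN _ hh9 U hU x
    simp only [h36] at this
    calc _ ≤ ENNReal.ofReal (9 * Real.pi * U) *
          (N * (2 * ∫⁻ s in Icc 0 T, h ((U + s) / 36))) := by gcongr
      _ = _ := by
        rw [show (18 * Real.pi * N * U) = (9 * Real.pi * U) * (N * 2) by ring,
          ENNReal.ofReal_mul (p := 9 * Real.pi * U) (by positivity),
          ENNReal.ofReal_mul (p := (N : ℝ)) (by positivity),
          ENNReal.ofReal_natCast, ENNReal.ofReal_ofNat]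
        simp only [mul_assoc]
  set K := 18 * Real.pi * N with hK
  have hK0 : 0 ≤ K := by positivity
  refine ⟨K * 1296 + K * 36 * (U₀ + T + 1), by positivity, fun U hU hUU x ↦ ?_⟩
  have hpos : ∀ s ∈ Icc 0 T, 0 < U + s := fun s hs ↦ by linarith [hs.1]
  have hB : ∀ y ∈ tube c (2 * U) \ Metric.ball x (U / 2), 0 < ‖x - y‖ := fun y hy ↦
    (half_pos hU).trans_le (ne_zero_and_le_norm_sub_of_notMem_ball (half_pos hU) hy.2).2
  have hBm : MeasurableSet (tube c (2 * U) \ Metric.ball x (U / 2)) :=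
    (hc.isCompact_tube _).measurableSet.diff Metric.isOpen_ball.measurableSet
  constructor
  · have h1 : ∫⁻ s in Icc 0 T, (ENNReal.ofReal ((U + s) / 36) ^ 2)⁻¹ =
        ENNReal.ofReal (-(1296 * (U + T)⁻¹) - -(1296 * (U + 0)⁻¹)) := by
      rw [← lintegral_Icc_ofReal_eq_sub (F := fun s ↦ -(1296 * (U + s)⁻¹))
        (g := fun s ↦ (((U + s) / 36) ^ 2)⁻¹) hT0.le]
      · refine setLIntegral_congr_fun measurableSet_Icc fun s hs ↦ ?_
        have := hpos s hs
        rw [← ENNReal.ofReal_pow (by positivity), ENNReal.ofReal_inv_of_pos (by positivity)]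
      · intro s hs
        have := (hpos s hs).ne'
        refine ((((hasDerivAt_id s).const_add U).inv this).const_mul 1296).neg.congr_deriv ?_
        simp only [id]
        field_simp
        norm_num
      · have : ∀ s ∈ Icc 0 T, ((U + s) / 36) ^ 2 ≠ 0 := fun s hs ↦ by
          have := hpos s hs
          positivity
        fun_prop (disch := assumption)
      · intro s hs
        positivity
    have h2 : ∫⁻ y in tube c (2 * U) \ Metric.ball x (U / 2),
        ENNReal.ofReal ((‖x - y‖ ^ 2)⁻¹) ≤ ENNReal.ofReal (K * 1296) := by
      calc _ = ∫⁻ y in tube c (2 * U) \ Metric.ball x (U / 2),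
            ((ENNReal.ofReal ‖x - y‖) ^ 2)⁻¹ := by
            refine setLIntegral_congr_fun hBm fun y hy ↦ ?_
            have := hB y hy
            rw [ENNReal.ofReal_inv_of_pos (by positivity), ENNReal.ofReal_pow (by positivity)]
        _ ≤ _ := hred _ antitone_inv_ofReal_sq U hU hUU x
        _ ≤ _ := by
            rw [h1, ← ENNReal.ofReal_mul (by positivity)]
            apply ENNReal.ofReal_le_ofReal
            have h3 : 0 ≤ (U + T)⁻¹ := by positivity
            have h4 : U * U⁻¹ = 1 := mul_inv_cancel₀ hU.ne'
            rw [add_zero, mul_assoc]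
            refine mul_le_mul_of_nonneg_left ?_ hK0
            nlinarith [mul_nonneg hU.le h3]
    have h5 := integrableOn_and_integral_le_of_lintegral_le (by fun_prop)
      (fun y ↦ by positivity) (by positivity) h2
    exact ⟨h5.1, h5.2.trans (le_add_of_nonneg_right (by positivity))⟩
  · have h1 : ∫⁻ s in Icc 0 T, (ENNReal.ofReal ((U + s) / 36))⁻¹ =
        ENNReal.ofReal (36 * Real.log (U + T) - 36 * Real.log (U + 0)) := by
      rw [← lintegral_Icc_ofReal_eq_sub (F := fun s ↦ 36 * Real.log (U + s))
        (g := fun s ↦ ((U + s) / 36)⁻¹) hT0.le]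
      · refine setLIntegral_congr_fun measurableSet_Icc fun s hs ↦ ?_
        have := hpos s hs
        rw [ENNReal.ofReal_inv_of_pos (by positivity)]
      · intro s hs
        have := (hpos s hs).ne'
        refine ((((hasDerivAt_id s).const_add U).log this).const_mul 36).congr_deriv ?_
        simp only [id]
        field_simp
      · have : ∀ s ∈ Icc 0 T, (U + s) / 36 ≠ 0 := fun s hs ↦ by
          have := hpos s hs
          positivity
        fun_prop (disch := assumption)
      · intro s hs
        have := hpos s hs
        positivity
    have h2 : ∫⁻ y in tube c (2 * U) \ Metric.ball x (U / 2),
        ENNReal.ofReal (‖x - y‖⁻¹) ≤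
          ENNReal.ofReal (K * 36 * (U₀ + T + 1) * (U * (1 + |Real.log U|))) := by
      calc _ = ∫⁻ y in tube c (2 * U) \ Metric.ball x (U / 2), (ENNReal.ofReal ‖x - y‖)⁻¹ := by
            refine setLIntegral_congr_fun hBm fun y hy ↦ ?_
            rw [ENNReal.ofReal_inv_of_pos (hB y hy)]
        _ ≤ _ := hred _ antitone_inv_ofReal U hU hUU x
        _ ≤ _ := by
            rw [h1, ← ENNReal.ofReal_mul (by positivity)]
            apply ENNReal.ofReal_le_ofReal
            rw [add_zero, ← mul_sub]
            have h3 : Real.log (U + T) ≤ U + T := by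
              linarith [Real.log_le_sub_one_of_pos (show 0 < U + T by positivity)]
            have h4 : Real.log (U + T) - Real.log U ≤ (U₀ + T + 1) * (1 + |Real.log U|) := by
              nlinarith [neg_abs_le (Real.log U), abs_nonneg (Real.log U)]
            calc _ = K * 36 * U * (Real.log (U + T) - Real.log U) := by ring
              _ ≤ K * 36 * U * ((U₀ + T + 1) * (1 + |Real.log U|)) := by gcongr
              _ = _ := by ring
    have h5 := integrableOn_and_integral_le_of_lintegral_le (by fun_prop)
      (fun y ↦ by positivity) (by positivity) h2
    refine h5.2.trans ?_
    gcongr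
    exact le_add_of_nonneg_left (by positivity)

end IsCenterline

/-! ### The field with prescribed curl -/

/-- The field `(2π)⁻¹ (∇φ)^⊥`, where `φ` is the logarithmic potential of `f` on `A`. -/
noncomputable def curlField (A : Set Plane) (f : Plane → ℝ) (x : Plane) : Plane :=
  (1 / (2 * Real.pi)) • perp (gradPotential A f 0 x)

section curlField

variable {A : Set Plane} {f g : Plane → ℝ} {α M L η r ρ : ℝ} {x : Plane}

lemma norm_curlField (A : Set Plane) (f : Plane → ℝ) (x : Plane) :
    ‖curlField A f x‖ = 1 / (2 * Real.pi) * ‖gradPotential A f 0 x‖ := by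
  rw [curlField, norm_smul, norm_perp, Real.norm_of_nonneg (by positivity)]

lemma hasFDerivAt_curlField {W : Plane →L[ℝ] Plane}
    (h : HasFDerivAt (gradPotential A f 0) W x) :
    HasFDerivAt (curlField A f)
      ((1 / (2 * Real.pi)) • perpIsometry.toContinuousLinearMap.comp W) x :=
  (perpIsometry.toContinuousLinearMap.hasFDerivAt.comp x h).const_smul (1 / (2 * Real.pi))

lemma curl_curlField {W : Plane →L[ℝ] Plane} (h : HasFDerivAt (gradPotential A f 0) W x) :
    curl (curlField A f) x = 1 / (2 * Real.pi) *
      ((W (EuclideanSpace.single 0 1)) 0 + (W (EuclideanSpace.single 1 1)) 1) := by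
  rw [curl, (hasFDerivAt_curlField h).fderiv]
  simp [perp]
  ring

lemma norm_fderiv_curlField {W : Plane →L[ℝ] Plane}
    (h : HasFDerivAt (gradPotential A f 0) W x) :
    ‖fderiv ℝ (curlField A f) x‖ = 1 / (2 * Real.pi) * ‖W‖ := by
  rw [(hasFDerivAt_curlField h).fderiv, norm_smul, Real.norm_of_nonneg (by positivity),
    LinearIsometry.norm_toContinuousLinearMap_comp]

lemma setIntegral_inv_norm_sub_le (hρ : 0 ≤ ρ) (hAx : A ⊆ Metric.ball x ρ) :
    ∫ y in A, ‖x - y‖⁻¹ ≤ 2 * Real.pi * ρ := by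
  have := setIntegral_norm_sub_rpow_le one_pos hρ hAx
  norm_num [Real.rpow_neg_one] at this
  exact this

lemma norm_curlField_sub_le (hA : MeasurableSet A) (hf : Continuous f) (hg : Continuous g)
    (hfM : ∀ y, |f y| ≤ M) (hgM : ∀ y, |g y| ≤ M) (hη : ∀ y, |f y - g y| ≤ η)
    (hρ : 0 ≤ ρ) (hAx : A ⊆ Metric.ball x ρ) :
    ‖curlField A f x - curlField A g x‖ ≤ η * ρ := by
  have hη0 : 0 ≤ η := (abs_nonneg _).trans (hη 0)
  have h1 : curlField A f x - curlField A g x = curlField A (fun y ↦ f y - g y) x := by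
    rw [curlField, curlField, curlField, ← smul_sub, ← perp_sub,
      gradPotential_sub hA hf hg (fun y _ ↦ hfM y) (fun y _ ↦ hgM y) hAx]
  rw [h1, norm_curlField]
  calc _ ≤ 1 / (2 * Real.pi) * (η * (2 * Real.pi * ρ)) := by
        gcongr
        refine (norm_gradPotential_le hA (fun y _ ↦ hη y) hAx).trans ?_
        gcongr
        exact setIntegral_inv_norm_sub_le hρ hAx
    _ = _ := by field_simp

lemma continuous_of_holder (hα : 0 < α) (hH : ∀ x y, |f x - f y| ≤ L * ‖x - y‖ ^ α) :
    Continuous f := by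
  rw [continuous_iff_continuousAt]
  intro x
  rw [ContinuousAt, tendsto_iff_norm_sub_tendsto_zero]
  refine squeeze_zero (fun _ ↦ norm_nonneg _) (fun y ↦ hH y x) ?_
  have h : Continuous fun y ↦ L * ‖y - x‖ ^ α :=
    continuous_const.mul ((by fun_prop : Continuous fun y ↦ ‖y - x‖).rpow_const
      fun _ ↦ Or.inr hα.le)
  simpa [Real.zero_rpow hα.ne'] using h.tendsto x

end curlField

namespace IsCenterline

variable {c : ℝ → Plane}

/-- The field generated by a Hölder density on the doubled tube, with bounds on the tube that do
not depend on its width. -/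
theorem exists_curlField_bound (hc : IsCenterline c) {α : ℝ} (hα0 : 0 < α) (hα1 : α < 1)
    {M L : ℝ} (hM0 : 0 ≤ M) (hL0 : 0 ≤ L) {U₀ : ℝ} (hU₀ : 0 < U₀) :
    ∃ K, ∀ U, 0 < U → U ≤ U₀ → ∀ f : Plane → ℝ, (∀ y, |f y| ≤ M) →
      (∀ x y, |f x - f y| ≤ L * ‖x - y‖ ^ α) → ∀ x ∈ tube c U,
        HasGradientAt (logPotential (tube c (2 * U)) f)
          (gradPotential (tube c (2 * U)) f 0 x) x ∧
        ContDiffAt ℝ 1 (curlField (tube c (2 * U)) f) x ∧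
        curl (curlField (tube c (2 * U)) f) x = f x ∧
        ‖curlField (tube c (2 * U)) f x‖ ≤ K * (U * (1 + |Real.log U|)) ∧
        ‖fderiv ℝ (curlField (tube c (2 * U)) f) x‖ ≤ K := by
  obtain ⟨ρ, hρ0, hAρ⟩ := hc.exists_tube_subset_ball (2 * U₀)
  obtain ⟨C, hC0, hC⟩ := hc.exists_integral_tube_le hU₀
  have hρ : 0 ≤ ρ := hρ0.le
  refine ⟨1 / (2 * Real.pi) * (M * (Real.pi + C)) +
    1 / (2 * Real.pi) * (3 * L * (2 * Real.pi * (ρ ^ α / α)) + M * (3 * C + Real.pi)),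
    fun U hU hUU f hM hH x hx ↦ ?_⟩
  set A := tube c (2 * U) with hAdef
  have hA : IsCompact A := hc.isCompact_tube _
  have hf : Continuous f := continuous_of_holder hα0 hH
  have hball : Metric.closedBall x U ⊆ A := hc.closedBall_subset_tube (by linarith) hx
  have hball' : Metric.ball x (U / 2) ⊆ A :=
    (Metric.ball_subset_closedBall.trans (Metric.closedBall_subset_closedBall (by linarith))).trans
      hball
  have hAx : A ⊆ Metric.ball x ρ := hAρ _ (by linarith) _ (by linarith) x hx
  have hr : 0 < U / 2 := half_pos hU
  obtain ⟨hgrad, hder, hcont⟩ := logPotential_regularity (r := U / 2) hA hf hα0 hα1 hH hM hr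
    (by rwa [mul_div_cancel₀ _ (two_ne_zero' ℝ)])
  have hx0 := Metric.mem_ball_self (x := x) hr
  obtain ⟨⟨hi, h2⟩, h1⟩ := hC U hU hUU x
  refine ⟨hgrad x hx0, ?_, ?_, ?_, ?_⟩
  · have h : ContDiffAt ℝ 1 (gradPotential A f 0) x :=
      contDiffAt_one_iff.2 ⟨_, _, Metric.isOpen_ball.mem_nhds hx0, hcont, hder⟩
    exact (perpIsometry.toContinuousLinearMap.contDiff.contDiffAt.comp x h).const_smul _
  · rw [curl_curlField (hder x hx0), logHessian_trace hA hf hα0 hH hr]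
    field_simp
  · rw [norm_curlField]
    have hint := integrableOn_inv_norm_sub hAx
    have hsplit : ∫ y in A, ‖x - y‖⁻¹ ≤ Real.pi * U + C * (U * (1 + |Real.log U|)) := by
      have h3 := setIntegral_sdiff Metric.isOpen_ball.measurableSet hint hball'
      have h4 := setIntegral_inv_norm_sub_le hr.le (subset_refl (Metric.ball x (U / 2)))
      linarith
    have h5 : Real.pi * U + C * (U * (1 + |Real.log U|)) ≤
        (Real.pi + C) * (U * (1 + |Real.log U|)) := by
      have : 0 ≤ Real.pi * U * |Real.log U| := by positivity
      linarith
    rw [add_mul]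
    refine le_trans ?_ (le_add_of_nonneg_right (by positivity))
    rw [mul_assoc, mul_assoc M]
    gcongr
    refine (norm_gradPotential_le hA.measurableSet (fun y _ ↦ hM y) hAx).trans ?_
    gcongr
    exact hsplit.trans h5
  · rw [norm_fderiv_curlField (hder x hx0)]
    refine le_trans ?_ (le_add_of_nonneg_left (by positivity))
    gcongr
    exact norm_logHessian_le hA hα0 hH hM hAx hρ hr hi h2

end IsCenterline

theorem mainTheorem6 (c : ℝ → Plane) (hc : IsCenterline c)
    (α : ℝ) (hα0 : 0 < α) (hα1 : α < 1) (M L : ℝ) :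
    ∃ K : ℝ, ∀ (Ω : Set Plane), IsOpen Ω →
      ∀ U : ℝ, 0 < U → U ≤ lfs c / 3 → tube c U ⊆ Ω →
      ∀ (X : Type*) [TopologicalSpace X] (ξ : X → Plane → ℝ),
        (∀ S, ContinuousOn (ξ S) (closure Ω)) →
        (∀ S, TendstoUniformlyOn ξ (ξ S) (𝓝 S) (closure Ω)) →
        (∀ S, ∀ x ∈ closure Ω, |ξ S x| ≤ M) →
        (∀ S, ∀ x ∈ closure Ω, ∀ y ∈ closure Ω, |ξ S x - ξ S y| ≤ L * ‖x - y‖ ^ α) →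
        ∃ ω : X → Plane → Plane,
          -- the explicit construction, whenever the doubled tube lies in the domain of `ξ`
          (tube c (2 * U) ⊆ closure Ω → ∀ S, ∀ x ∈ tube c U,
            DifferentiableAt ℝ (logPotential (tube c (2 * U)) (ξ S)) x ∧
            ω S x = (1 / (2 * Real.pi)) •
              perp (gradient (logPotential (tube c (2 * U)) (ξ S)) x)) ∧
          -- each `ω S` is `C¹` in a neighbourhood of the closed tube
          (∀ S, ∀ x ∈ tube c U, ContDiffAt ℝ 1 (ω S) x) ∧
          (∀ S, ∀ x ∈ tube c U, curl (ω S) x = ξ S x) ∧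
          (∀ S, ∀ x ∈ tube c U, ‖ω S x‖ ≤ K * (U * (1 + |Real.log U|))) ∧
          (∀ S, ∀ x ∈ tube c U, ‖fderiv ℝ (ω S) x‖ ≤ K) ∧
          (∀ S, TendstoUniformlyOn ω (ω S) (𝓝 S) (tube c U)) := by
  -- The local feature size enters as an upper bound for the half-width.
  set U₀ := max (lfs c / 3) 1
  obtain ⟨K, hK⟩ := hc.exists_curlField_bound hα0 hα1 (abs_nonneg M) (abs_nonneg L)
    (show 0 < U₀ from lt_max_of_lt_right one_pos)
  refine ⟨K, fun Ω _ U hU hUlfs hUΩ X _ ξ _ hξu hξM hξL ↦ ?_⟩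
  have hUU : U ≤ U₀ := hUlfs.trans (le_max_left _ _)
  set A := tube c (2 * U) with hAdef
  have hM : ∀ S, ∀ x ∈ closure Ω, |ξ S x| ≤ |M| := fun S x hx ↦
    (hξM S x hx).trans (le_abs_self M)
  have hL : ∀ S, ∀ x ∈ closure Ω, ∀ y ∈ closure Ω, |ξ S x - ξ S y| ≤ |L| * ‖x - y‖ ^ α :=
    fun S x hx y hy ↦ (hξL S x hx y hy).trans (by gcongr; exact le_abs_self L)
  set f : X → Plane → ℝ := fun S ↦ holderExtend (closure Ω) α |M| |L| (ξ S) with hf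
  have hfM : ∀ S y, |f S y| ≤ |M| := fun S y ↦ abs_holderExtend_le (abs_nonneg M) y
  have hfL : ∀ S x y, |f S x - f S y| ≤ |L| * ‖x - y‖ ^ α := fun S x y ↦
    abs_holderExtend_sub_le hα0 hα1 (abs_nonneg L) (hM S) x y
  have hfξ : ∀ S, ∀ x ∈ closure Ω, f S x = ξ S x := fun S x hx ↦
    holderExtend_eq hα0 (abs_nonneg L) (hM S) (hL S) hx
  have hfc : ∀ S, Continuous (f S) := fun S ↦ continuous_of_holder hα0 (hfL S)
  have key := fun S x hx ↦ hK U hU hUU (f S) (hfM S) (hfL S) x hx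
  refine ⟨fun S ↦ curlField A (f S), ?_, fun S x hx ↦ (key S x hx).2.1, fun S x hx ↦ ?_,
    fun S x hx ↦ (key S x hx).2.2.2.1, fun S x hx ↦ (key S x hx).2.2.2.2, fun S ↦ ?_⟩
  · intro hAΩ S x hx
    have hpot : logPotential A (ξ S) = logPotential A (f S) := by
      ext z
      refine setIntegral_congr_fun (hc.isCompact_tube _).measurableSet fun y hy ↦ ?_
      simp only [hfξ S y (hAΩ hy)]
    have hgrad := (key S x hx).1
    rw [hpot]
    exact ⟨hgrad.differentiableAt, by rw [hgrad.gradient]; rfl⟩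
  · rw [(key S x hx).2.2.1, hfξ S x (subset_closure (hUΩ hx))]
  · obtain ⟨ρ, hρ, hAρ⟩ := hc.exists_tube_subset_ball (2 * U)
    rw [Metric.tendstoUniformlyOn_iff]
    intro δ hδ
    have hη : 0 < δ / (ρ + 1) := by positivity
    filter_upwards [Metric.tendstoUniformlyOn_iff.1 (hξu S) _ hη] with S' hS' x hx
    have hAx : A ⊆ Metric.ball x ρ := hAρ _ le_rfl _ (by linarith) x hx
    have hclose : ∀ y, |f S y - f S' y| ≤ δ / (ρ + 1) := fun y ↦
      abs_holderExtend_sub_holderExtend_le (abs_nonneg L) hη.le (hM S) (hM S')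
        (fun z hz ↦ by rw [← Real.dist_eq]; exact (hS' z hz).le) y
    rw [dist_eq_norm]
    refine (norm_curlField_sub_le (hc.isCompact_tube _).measurableSet (hfc S) (hfc S') (hfM S)
      (hfM S') hclose hρ.le hAx).trans_lt ?_
    rw [div_mul_eq_mul_div, div_lt_iff₀ (by positivity)]
    nlinarith
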